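/- Let $\Omega$ be a Polish space with Borel $\sigma$-algebra ${\cal B}(\Omega)$, and let $({\cal F}_t)_{t\ge 0}$ be a right-continuous (not necessarily completed) filtration with $\sigma(\bigcup_t{\cal F}_t)={\cal B}(\Omega)$. Stopping times take values in $[0,\infty]$. Let ${\cal C}$ be a nonempty convex set of Borel probability measures on $\Omega$, compact for the topology of weak convergence, which is \emph{stable}: for all $P,Q\in{\cal C}$ with $Q\ll P$ and every stopping time $\tau$ there is $R\in{\cal C}$, $R\ll P$, whose density process satisfies, for every $t \ge 0$, $(\frac{dR}{dP})_t=(\frac{dQ}{dP})_t$ for $t\le\tau$ and $(\frac{dR}{dP})_t=(\frac{dQ}{dP})_\tau$ for $t\ge\tau$ ($P$-a.s.), where $(\frac{dQ}{dP})_t=E_P(\frac{dQ}{dP}\mid{\cal F}_t)$ and $(\frac{dQ}{dP})_\tau=E_P(\frac{dQ}{dP}\mid{\cal F}_\tau)$. Put $\rho(X)=\sup_{Q\in{\cal C}}E_Q(-X)$ and $c_\rho(X)=\rho(-|X|)$ for $X\in{\cal C}_b(\Omega)$ (bounded continuous real functions), and let $L^1(c_\rho)$ be the separated completion of ${\cal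 C}_b(\Omega)$ for the seminorm $c_\rho$. A probability measure $P$ belongs to the \emph{canonical $c_\rho$-class} if $|E_P(X)|\le c_\rho(X)$ for all $X\in{\cal C}_b(\Omega)$ and if, for all $X,Y\in L^1(c_\rho)$, one has $X=Y$ in $L^1(c_\rho)$ if and only if $X=Y$ $P$-a.s. (i.e. $X$ and $Y$ have the same image under the continuous extension $L^1(c_\rho)\to L^1(P)$ of the canonical map ${\cal C}_b(\Omega)\to L^1(P)$). Assume that ${\cal F}_0$ is trivial, in the sense that $P(A)\in\{0,1\}$ for every $A\in{\cal F}_0$ and every $P\in{\cal C}$ belonging to the canonical $c_\rho$-class. Then there are a probability measure $P\in{\cal C}$ belonging to the canonical $c_\rho$-class and a set ${\cal S}$ of probability measures absolutely continuous with respect to $P$ such that: 1. ${\cal S}$ is \emph{m-stable} for $({\cal F}_t)$ and $P$: for all $Q^0,Q\in{\cal S}$ with $Q\sim P$, with density processes $Z^0,Z$ with respect to $P$, and every stopping time $\tau$, there is an element of ${\cal S}$ whose density process with respect to $P$ equals $Z^0_t$ for $t\le\tau$ and $Z^0_\tau Z_t/Z_\tau$ for $t\ge\tau$; moreover, every probability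 measure having an ${\cal F}_0$-measurable density with respect to $P$ belongs to ${\cal S}$. 2. $\rho(X)=\sup_{Q\in{\cal S}}E_Q(-X)$ for every $X\in{\cal C}_b(\Omega)$. 3. For every stopping time $\sigma$ and every $X\in L^\infty(P)$ the $P$-essential supremum $$\rho_\sigma(X)=\operatorname{esssup}_{Q\in{\cal S},\,Q\sim P}E_Q(-X\mid{\cal F}_\sigma)\quad P\text{-a.s.}$$ defines an element of $L^\infty(\Omega,{\cal F}_\sigma,P)$, and $(\rho_\sigma)_\sigma$ is a time-consistent sublinear dynamic risk measure on $L^\infty(P)$: each $\rho_\sigma$ is monotone ($X\le Y$ implies $\rho_\sigma(Y)\le\rho_\sigma(X)$), translation invariant ($\rho_\sigma(X+Y)=\rho_\sigma(X)-Y$ for $Y\in L^\infty({\cal F}_\sigma,P)$), convex and positively homogeneous, and $\rho_\sigma(-\rho_\tau(X))=\rho_\sigma(X)$ for all stopping times $\sigma\le\tau$ and all $X\in L^\infty(P)$. 4. $\rho_0(X)=\rho(X)$ $P$-a.s. for every $X\in{\cal C}_b(\Omega)$. -/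

import Mathlib

open MeasureTheory Set Filter Topology
open scoped NNReal ENNReal BoundedContinuousFunction Pointwise

noncomputable section

namespace StableRisk

section Completion

variable {Ω : Type*} [TopologicalSpace Ω]

/-- Bounded continuous functions, endowed with the seminorm `c` instead of the uniform norm. -/
def CapSpace (_c : Seminorm ℝ (Ω →ᵇ ℝ)) : Type _ := Ω →ᵇ ℝ

instance (c : Seminorm ℝ (Ω →ᵇ ℝ)) : AddCommGroup (CapSpace c) :=
  inferInstanceAs (AddCommGroup (Ω →ᵇ ℝ))

instance (c : Seminorm ℝ (Ω →ᵇ ℝ)) : Module ℝ (CapSpace c) :=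
  inferInstanceAs (Module ℝ (Ω →ᵇ ℝ))

/-- The identity map from `CapSpace c` to bounded continuous functions. -/
def CapSpace.toBCF (c : Seminorm ℝ (Ω →ᵇ ℝ)) : CapSpace c ≃ₗ[ℝ] (Ω →ᵇ ℝ) :=
  LinearEquiv.refl ℝ (Ω →ᵇ ℝ)

instance (c : Seminorm ℝ (Ω →ᵇ ℝ)) : SeminormedAddCommGroup (CapSpace c) :=
  (c.comp (CapSpace.toBCF c).toLinearMap).toAddGroupSeminorm.toSeminormedAddCommGroup

theorem CapSpace.norm_eq (c : Seminorm ℝ (Ω →ᵇ ℝ)) (X : CapSpace c) :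
    ‖X‖ = c (CapSpace.toBCF c X) := rfl

instance (c : Seminorm ℝ (Ω →ᵇ ℝ)) : NormedSpace ℝ (CapSpace c) where
  norm_smul_le a X := by
    rw [CapSpace.norm_eq, CapSpace.norm_eq, map_smul, map_smul_eq_mul]

/-- The Banach space `L¹(c)`: the separated completion of the bounded continuous functions with
respect to the seminorm `c`. -/
abbrev L1Cap (c : Seminorm ℝ (Ω →ᵇ ℝ)) : Type _ := UniformSpace.Completion (CapSpace c)

end Completion

section Capacity

variable {Ω : Type*} [TopologicalSpace Ω] [MeasurableSpace Ω]

/-- Convexity of a set of probability measures, as a set of measures. -/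
def IsConvex (C : Set (ProbabilityMeasure Ω)) : Prop :=
  Convex ℝ≥0 ((fun Q : ProbabilityMeasure Ω => (Q : Measure Ω)) '' C)

/-- The risk measure `ρ(X) = sup_{Q ∈ C} E_Q(-X)` on bounded continuous functions. The set of
values is bounded above by `‖X‖`, so this is a genuine supremum as soon as `C` is nonempty. -/
def riskMeasure (C : Set (ProbabilityMeasure Ω)) (X : Ω →ᵇ ℝ) : ℝ :=
  sSup ((fun Q : ProbabilityMeasure Ω => ∫ ω, -X ω ∂(Q : Measure Ω)) '' C)

theorem integral_neg_le_norm (Q : ProbabilityMeasure Ω) (X : Ω →ᵇ ℝ) :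
    ∫ ω, -X ω ∂(Q : Measure Ω) ≤ ‖X‖ := by
  have h := norm_integral_le_of_norm_le_const (μ := (Q : Measure Ω)) (f := fun ω => -X ω)
    (C := ‖X‖) (Eventually.of_forall fun ω => by simpa using X.norm_coe_le_norm ω)
  simp only [probReal_univ, mul_one] at h
  exact (le_abs_self _).trans h

theorem bddAbove_riskMeasure (C : Set (ProbabilityMeasure Ω)) (X : Ω →ᵇ ℝ) :
    BddAbove ((fun Q : ProbabilityMeasure Ω => ∫ ω, -X ω ∂(Q : Measure Ω)) '' C) := by
  refine ⟨‖X‖, ?_⟩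
  rintro _ ⟨Q, -, rfl⟩
  exact integral_neg_le_norm Q X

variable [BorelSpace Ω]

/-- The capacity `c_ρ(X) = ρ(-|X|)` attached to `ρ = riskMeasure C`, as a seminorm on bounded
continuous functions. -/
def riskCapacity (C : Set (ProbabilityMeasure Ω)) : Seminorm ℝ (Ω →ᵇ ℝ) :=
  Seminorm.of (fun X => riskMeasure C (-|X|))
    (by
      intro X Y
      rcases C.eq_empty_or_nonempty with rfl | hC
      · simp [riskMeasure]
      · refine csSup_le (hC.image _) ?_
        rintro _ ⟨Q, hQ, rfl⟩
        have key : ∀ Z : Ω →ᵇ ℝ, ∫ ω, -(-|Z|) ω ∂(Q : Measure Ω) ≤ riskMeasure C (-|Z|) :=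
          fun Z => le_csSup (bddAbove_riskMeasure C _) ⟨Q, hQ, rfl⟩
        refine le_trans ?_ (add_le_add (key X) (key Y))
        have hi : ∀ Z : Ω →ᵇ ℝ, Integrable (fun ω => -(-|Z|) ω) (Q : Measure Ω) :=
          fun Z => ((-|Z|).integrable _).neg
        rw [← integral_add (hi X) (hi Y)]
        refine integral_mono (hi _) ((hi X).add (hi Y)) fun ω => ?_
        simpa using abs_add_le (X ω) (Y ω))
    (by
      intro a X
      have h : ((fun Q : ProbabilityMeasure Ω => ∫ ω, -(-|a • X|) ω ∂(Q : Measure Ω)) '' C)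
          = ‖a‖ • ((fun Q : ProbabilityMeasure Ω => ∫ ω, -(-|X|) ω ∂(Q : Measure Ω)) '' C) := by
        rw [← image_smul, image_image]
        refine image_congr fun Q _ => ?_
        simp [abs_mul, integral_const_mul]
      simp only [riskMeasure]
      rw [h, Real.sSup_smul_of_nonneg (norm_nonneg a), smul_eq_mul])

/-- `P` belongs to `K₊`: the form `X ↦ E_P(X)`, which is nonnegative because `P` is a measure,
lies in the unit ball of the dual of `L¹(c)`. -/
def InUnitBall (c : Seminorm ℝ (Ω →ᵇ ℝ)) (P : ProbabilityMeasure Ω) : Prop :=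
  ∀ X : Ω →ᵇ ℝ, |∫ ω, X ω ∂(P : Measure Ω)| ≤ c X

theorem norm_toLp_le (C : Set (ProbabilityMeasure Ω)) (P : ProbabilityMeasure Ω)
    (hP : InUnitBall (riskCapacity C) P) (Z : Ω →ᵇ ℝ) :
    ‖BoundedContinuousFunction.toLp (E := ℝ) 1 (P : Measure Ω) ℝ Z‖ ≤ riskCapacity C Z := by
  have h2 : ‖BoundedContinuousFunction.toLp (E := ℝ) 1 (P : Measure Ω) ℝ Z‖
      = ∫ ω, |Z| ω ∂(P : Measure Ω) := by
    rw [L1.norm_eq_integral_norm]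
    refine integral_congr_ae ?_
    filter_upwards [BoundedContinuousFunction.coeFn_toLp (p := 1) (P : Measure Ω) ℝ Z] with ω hω
    rw [hω]
    simp
  have h3 : riskCapacity C |Z| = riskCapacity C Z := by
    change riskMeasure C (-|(|Z|)|) = riskMeasure C (-|Z|)
    rw [abs_abs]
  rw [h2, ← h3]
  exact (le_abs_self _).trans (hP |Z|)

/-- The `P`-almost sure class of an element of `L¹(c)`: the continuous extension to `L¹(c)` of the
map sending a bounded continuous function to its class in `L¹(P)`. It is meant for `P` in `K₊`,
where that map is 1-Lipschitz (see `uniformContinuous_toLp`). -/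
def toL1 (c : Seminorm ℝ (Ω →ᵇ ℝ)) (P : ProbabilityMeasure Ω) :
    L1Cap c → Lp ℝ 1 (P : Measure Ω) :=
  UniformSpace.Completion.extension fun X : CapSpace c =>
    BoundedContinuousFunction.toLp 1 (P : Measure Ω) ℝ (CapSpace.toBCF c X)

theorem uniformContinuous_toLp (C : Set (ProbabilityMeasure Ω)) (P : ProbabilityMeasure Ω)
    (hP : InUnitBall (riskCapacity C) P) :
    UniformContinuous fun X : CapSpace (riskCapacity C) =>
      BoundedContinuousFunction.toLp (E := ℝ) 1 (P : Measure Ω) ℝ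
        (CapSpace.toBCF (riskCapacity C) X) := by
  refine LipschitzWith.uniformContinuous (K := 1) (LipschitzWith.of_dist_le_mul fun X Y => ?_)
  rw [dist_eq_norm, dist_eq_norm, NNReal.coe_one, one_mul, ← map_sub, ← map_sub,
    CapSpace.norm_eq]
  exact norm_toLp_le C P hP _

/-- `P` belongs to the canonical `c`-class: `P ∈ K₊`, and equality in `L¹(c)` is the same as
`P`-almost sure equality. -/
structure InCanonicalClass (c : Seminorm ℝ (Ω →ᵇ ℝ)) (P : ProbabilityMeasure Ω) : Prop where
  inUnitBall : InUnitBall c P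
  ae_eq_iff : ∀ X Y : L1Cap c, toL1 c P X = toL1 c P Y ↔ X = Y

end Capacity

section Dynamic

variable {Ω : Type*} {mΩ : MeasurableSpace Ω}

/-- Stopping times with values in `[0, ∞]`. -/
abbrev StopTime (F : Filtration ℝ≥0 mΩ) : Type _ :=
  {τ : Ω → WithTop ℝ≥0 // IsStoppingTime F τ}

/-- The σ-algebra `F_τ`. -/
abbrev StopTime.sigma {F : Filtration ℝ≥0 mΩ} (τ : StopTime F) : MeasurableSpace Ω :=
  τ.2.measurableSpace

/-- The stopping time `0`. -/
def StopTime.zero (F : Filtration ℝ≥0 mΩ) : StopTime F :=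
  ⟨fun _ => ((0 : ℝ≥0) : WithTop ℝ≥0), isStoppingTime_const F 0⟩

/-- The conditional density `E_P(dQ/dP | m)`. For `m = F_t` it is the density process
`(dQ/dP)_t` at time `t`, and for `m = F_τ` it is, by optional stopping, the value `(dQ/dP)_τ` of
that process at the stopping time `τ`. -/
def dens (m : MeasurableSpace Ω) {mΩ : MeasurableSpace Ω} (P Q : ProbabilityMeasure Ω) : Ω → ℝ :=
  (P : Measure Ω)[fun ω => ((Q : Measure Ω).rnDeriv (P : Measure Ω) ω).toReal | m]

/-- Stability: for `P, Q ∈ C` with `Q ≪ P` and a stopping time `τ`, some `R ∈ C` with `R ≪ P` has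
the density process of `Q` stopped at `τ`. -/
def IsStable (F : Filtration ℝ≥0 mΩ) (C : Set (ProbabilityMeasure Ω)) : Prop :=
  ∀ P ∈ C, ∀ Q ∈ C, (Q : Measure Ω) ≪ (P : Measure Ω) → ∀ τ : StopTime F,
    ∃ R ∈ C, (R : Measure Ω) ≪ (P : Measure Ω) ∧ ∀ t : ℝ≥0,
      (∀ᵐ ω ∂(P : Measure Ω), (t : WithTop ℝ≥0) ≤ τ.1 ω →
        dens (F t) P R ω = dens (F t) P Q ω) ∧
      (∀ᵐ ω ∂(P : Measure Ω), τ.1 ω ≤ (t : WithTop ℝ≥0) →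
        dens (F t) P R ω = dens τ.sigma P Q ω)

/-- Multiplicative stability of a set `S` of probability measures absolutely continuous with
respect to `P`: for `Q₀, Q ∈ S` with `Q ∼ P`, having density processes `Z⁰` and `Z`, and every
stopping time `τ`, the process equal to `Z⁰_t` for `t ≤ τ` and to `Z⁰_τ Z_t / Z_τ` for `t ≥ τ` is
the density process of an element of `S`; moreover every probability measure with an
`F_0`-measurable density belongs to `S`. -/
structure IsMStable (F : Filtration ℝ≥0 mΩ) (P : ProbabilityMeasure Ω)
    (S : Set (ProbabilityMeasure Ω)) : Prop where
  ac : ∀ Q ∈ S, (Q : Measure Ω) ≪ (P : Measure Ω)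
  paste : ∀ Q₀ ∈ S, ∀ Q ∈ S, (P : Measure Ω) ≪ (Q : Measure Ω) → ∀ τ : StopTime F,
    ∃ R ∈ S, ∀ t : ℝ≥0,
      (∀ᵐ ω ∂(P : Measure Ω), (t : WithTop ℝ≥0) ≤ τ.1 ω →
        dens (F t) P R ω = dens (F t) P Q₀ ω) ∧
      (∀ᵐ ω ∂(P : Measure Ω), τ.1 ω ≤ (t : WithTop ℝ≥0) →
        dens (F t) P R ω = dens τ.sigma P Q₀ ω * dens (F t) P Q ω / dens τ.sigma P Q ω)
  initial : ∀ R : ProbabilityMeasure Ω, (R : Measure Ω) ≪ (P : Measure Ω) →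
    AEStronglyMeasurable[F 0]
      (fun ω => ((R : Measure Ω).rnDeriv (P : Measure Ω) ω).toReal) (P : Measure Ω) → R ∈ S

/-- The family `{E_Q(-X | m) : Q ∈ S, Q ∼ P}`, as a set of classes modulo `P`-almost sure
equality. -/
def condFamily (m : MeasurableSpace Ω) {mΩ : MeasurableSpace Ω} (P : ProbabilityMeasure Ω)
    (S : Set (ProbabilityMeasure Ω)) (X : Lp ℝ ∞ (P : Measure Ω)) : Set (Ω →ₘ[(P : Measure Ω)] ℝ) :=
  {g | ∃ Q ∈ S, (Q : Measure Ω) ≪ (P : Measure Ω) ∧ (P : Measure Ω) ≪ (Q : Measure Ω) ∧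
    ⇑g =ᵐ[(P : Measure Ω)] (Q : Measure Ω)[fun ω => -X ω | m]}

/-- `Y` is the `P`-essential supremum of `E_Q(-X | m)` over `Q ∈ S`, `Q ∼ P`: the least upper bound
for the `P`-almost sure order. -/
def IsCondEssSup (m : MeasurableSpace Ω) {mΩ : MeasurableSpace Ω} (P : ProbabilityMeasure Ω)
    (S : Set (ProbabilityMeasure Ω)) (X Y : Lp ℝ ∞ (P : Measure Ω)) : Prop :=
  IsLUB (condFamily m P S X) (Y : Ω →ₘ[(P : Measure Ω)] ℝ)

/-- A sublinear dynamic risk measure on `L^∞(P)`: a family of maps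
`ρ_σ : L^∞(P) → L^∞(F_σ, P)` indexed by the stopping times, each of them monotone, translation
invariant, convex and positively homogeneous. -/
structure IsDynamicRiskMeasure (F : Filtration ℝ≥0 mΩ) (P : ProbabilityMeasure Ω)
    (ρ : StopTime F → Lp ℝ ∞ (P : Measure Ω) → Lp ℝ ∞ (P : Measure Ω)) : Prop where
  adapted : ∀ σ X, AEStronglyMeasurable[σ.sigma] (ρ σ X) (P : Measure Ω)
  monotone : ∀ σ X Y, X ≤ Y → ρ σ Y ≤ ρ σ X
  translation : ∀ σ, ∀ X Y : Lp ℝ ∞ (P : Measure Ω), AEStronglyMeasurable[σ.sigma] Y (P : Measure Ω) →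
    ρ σ (X + Y) = ρ σ X - Y
  convex : ∀ σ X Y, ∀ a : ℝ, 0 ≤ a → a ≤ 1 →
    ρ σ (a • X + (1 - a) • Y) ≤ a • ρ σ X + (1 - a) • ρ σ Y
  posHom : ∀ σ X, ∀ a : ℝ, 0 ≤ a → ρ σ (a • X) = a • ρ σ X

/-- Time consistency: `ρ_σ(-ρ_τ(X)) = ρ_σ(X)` for all stopping times `σ ≤ τ`. -/
def IsTimeConsistent (F : Filtration ℝ≥0 mΩ) (P : ProbabilityMeasure Ω)
    (ρ : StopTime F → Lp ℝ ∞ (P : Measure Ω) → Lp ℝ ∞ (P : Measure Ω)) : Prop :=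
  ∀ σ τ : StopTime F, σ.1 ≤ τ.1 → ∀ X, ρ σ (-ρ τ X) = ρ σ X

end Dynamic

end StableRisk

end

/-! Choose a countable weakly dense sequence `Q n` in `C` and set `P = ∑ 2^{-(n+1)} Q n`. This is a
weak limit of convex combinations, so compactness puts it in `C` (`exists_dominating`). An element
of `L¹(c_ρ)` vanishing under `P` vanishes under every `Q n`, and `c_ρ` is the supremum over the `Q
n` alone, so `P` lies in the canonical class (`inCanonicalClass_of_dominating`). Take `S` to be the
elements of `C` absolutely continuous with respect to `P`.

Everything dynamic rests on one use of stability. With an equivalent `Q` as reference measure,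
stopping the density of `Q₀` at `τ` gives `R` with `dR/dQ = (dQ₀/dQ)_τ`: `R` is `Q₀` on `F_τ` and
has the conditional expectations of `Q` given `F_τ`. The chain rule for densities turns this into
m-stability (`IsStable.isMStable`), and the tower property into a pasting rule
(`IsStable.isEquivPasting`). Pasting makes the conditional expectations upward directed, so the
essential supremum is a sequential limit, and time consistency follows by dominated convergence. At
time 0 triviality of `F_0` turns conditional expectations into expectations, and mixing with `P`
reaches the measures that are not equivalent to it (`IsCondSup.eq_riskMeasure`). -/

namespace StableRisk

/-! ### Conditional densities and change of measure. -/

section Density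

variable {Ω : Type*} {m mΩ : MeasurableSpace Ω} {P Q R Q₀ : ProbabilityMeasure Ω}

theorem stronglyMeasurable_dens : StronglyMeasurable[m] (dens m P Q) := stronglyMeasurable_condExp

theorem integrable_dens : Integrable (dens m P Q) (P : Measure Ω) := integrable_condExp

/-- Pulling the `m`-measurable factor out of the conditional expectation shows that, for such
integrands, `dens m P Q` serves as well as the full density. -/
theorem setIntegral_mul_dens (hm : m ≤ mΩ) (hQP : (Q : Measure Ω) ≪ (P : Measure Ω)) {f : Ω → ℝ}
    (hf : StronglyMeasurable[m] f) (hfi : Integrable f (Q : Measure Ω)) {A : Set Ω}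
    (hA : MeasurableSet[m] A) :
    IntegrableOn (fun ω => f ω * dens m P Q ω) A (P : Measure Ω) ∧
      ∫ ω in A, f ω * dens m P Q ω ∂(P : Measure Ω) = ∫ ω in A, f ω ∂(Q : Measure Ω) := by
  have h1 : Integrable (f * fun ω => ((Q : Measure Ω).rnDeriv (P : Measure Ω) ω).toReal)
      (P : Measure Ω) := by
    have := (integrable_toReal_rnDeriv_mul_iff hQP).2 hfi
    exact this.congr (Eventually.of_forall fun ω => mul_comm _ _)
  have h2 := condExp_mul_of_stronglyMeasurable_left hf h1 Measure.integrable_toReal_rnDeriv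
  constructor
  · exact (integrable_condExp.congr h2).integrableOn
  · calc ∫ ω in A, f ω * dens m P Q ω ∂(P : Measure Ω)
        = ∫ ω in A, ((P : Measure Ω)[f * fun ω =>
            ((Q : Measure Ω).rnDeriv (P : Measure Ω) ω).toReal | m]) ω ∂(P : Measure Ω) :=
          integral_congr_ae (ae_restrict_of_ae (h2.mono fun ω h => h.symm))
      _ = ∫ ω in A, ((Q : Measure Ω).rnDeriv (P : Measure Ω) ω).toReal * f ω ∂(P : Measure Ω) := by
          rw [setIntegral_condExp hm h1 hA]
          simp only [Pi.mul_apply, mul_comm]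
      _ = _ := setIntegral_toReal_rnDeriv_mul hQP (hm _ hA)

theorem setIntegral_dens (hm : m ≤ mΩ) (hQP : (Q : Measure Ω) ≪ (P : Measure Ω)) {A : Set Ω}
    (hA : MeasurableSet[m] A) :
    ∫ ω in A, dens m P Q ω ∂(P : Measure Ω) = (Q : Measure Ω).real A := by
  rw [dens, setIntegral_condExp hm Measure.integrable_toReal_rnDeriv hA,
    Measure.setIntegral_toReal_rnDeriv hQP]

theorem dens_mul (hm : m ≤ mΩ) (hRQ : (R : Measure Ω) ≪ (Q : Measure Ω))
    (hQP : (Q : Measure Ω) ≪ (P : Measure Ω)) :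
    dens m P R =ᵐ[(P : Measure Ω)] fun ω => dens m Q R ω * dens m P Q ω := by
  refine (ae_eq_condExp_of_forall_setIntegral_eq hm Measure.integrable_toReal_rnDeriv
    (fun A hA _ => ?_) (fun A hA _ => ?_) ?_).symm
  · exact (setIntegral_mul_dens hm hQP stronglyMeasurable_dens integrable_dens hA).1
  · rw [(setIntegral_mul_dens hm hQP stronglyMeasurable_dens integrable_dens hA).2,
      setIntegral_dens hm hRQ hA, Measure.setIntegral_toReal_rnDeriv (hRQ.trans hQP)]
  · exact (stronglyMeasurable_dens.mul stronglyMeasurable_dens).aestronglyMeasurable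

/-- The `Q`-mass of the set where the density is nonpositive is the integral of the density over it,
hence zero; equivalence makes the set `P`-null. -/
theorem dens_pos (hm : m ≤ mΩ) (hQP : (Q : Measure Ω) ≪ (P : Measure Ω))
    (hPQ : (P : Measure Ω) ≪ (Q : Measure Ω)) : ∀ᵐ ω ∂(P : Measure Ω), 0 < dens m P Q ω := by
  have hA : MeasurableSet[m] {ω | dens m P Q ω ≤ 0} :=
    stronglyMeasurable_dens.measurable measurableSet_Iic
  have h1 := setIntegral_dens hm hQP hA
  have h2 : ∫ ω in {ω | dens m P Q ω ≤ 0}, dens m P Q ω ∂(P : Measure Ω) ≤ 0 :=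
    setIntegral_nonpos (hm _ hA) fun ω hω => hω
  have h3 : (Q : Measure Ω).real {ω | dens m P Q ω ≤ 0} = 0 :=
    le_antisymm (h1 ▸ h2) measureReal_nonneg
  have h4 : (P : Measure Ω) {ω | dens m P Q ω ≤ 0} = 0 := hPQ ((measureReal_eq_zero_iff).1 h3)
  rw [ae_iff]
  simpa only [not_lt] using h4

theorem memLp_top_of_ac {μ ν : Measure Ω} {Y : Ω → ℝ} (hY : MemLp Y ∞ μ) (h : ν ≪ μ) :
    MemLp Y ∞ ν := by
  refine ⟨hY.1.mono_ac h, ?_⟩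
  have := hY.2
  rw [eLpNorm_exponent_top] at this ⊢
  exact (eLpNormEssSup_mono_measure Y h).trans_lt this

theorem ae_bound_of_memLp_top {μ : Measure Ω} {Y : Ω → ℝ} (hY : MemLp Y ∞ μ) :
    ∃ c : ℝ≥0, ∀ᵐ ω ∂μ, |Y ω| ≤ c := by
  refine ⟨(eLpNorm Y ∞ μ).toNNReal, ?_⟩
  have h := ae_le_eLpNormEssSup (f := Y) (μ := μ)
  rw [← eLpNorm_exponent_top] at h
  filter_upwards [h] with ω hω
  rw [← ENNReal.coe_toNNReal hY.2.ne, ← ofReal_norm, ENNReal.ofReal_le_coe] at hω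
  simpa using hω

theorem integral_eq_of_trim_eq (hm : m ≤ mΩ) {μ ν : Measure Ω} (h : μ.trim hm = ν.trim hm)
    {f : Ω → ℝ} (hf : StronglyMeasurable[m] f) : ∫ ω, f ω ∂μ = ∫ ω, f ω ∂ν := by
  rw [integral_trim hm hf, h, ← integral_trim hm hf]

theorem setIntegral_eq_of_trim_eq (hm : m ≤ mΩ) {μ ν : Measure Ω} (h : μ.trim hm = ν.trim hm)
    {f : Ω → ℝ} (hf : StronglyMeasurable[m] f) {A : Set Ω} (hA : MeasurableSet[m] A) :
    ∫ ω in A, f ω ∂μ = ∫ ω in A, f ω ∂ν := by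
  rw [← integral_indicator (hm _ hA), ← integral_indicator (hm _ hA)]
  exact integral_eq_of_trim_eq hm h (hf.indicator hA)

/-- If the density of `R` with respect to `Q` is `(dQ₀/dQ)_m`, then `R` agrees with `Q₀` on `m`. -/
theorem trim_eq_of_density (hm : m ≤ mΩ) (hRQ : (R : Measure Ω) ≪ (Q : Measure Ω))
    (hQ₀ : (Q₀ : Measure Ω) ≪ (Q : Measure Ω))
    (hR : (fun ω => ((R : Measure Ω).rnDeriv (Q : Measure Ω) ω).toReal)
      =ᵐ[(Q : Measure Ω)] dens m Q Q₀) :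
    (R : Measure Ω).trim hm = (Q₀ : Measure Ω).trim hm := by
  refine @Measure.ext _ m _ _ fun A hA => ?_
  rw [trim_measurableSet_eq hm hA, trim_measurableSet_eq hm hA,
    ← measureReal_eq_measureReal_iff, ← setIntegral_dens hm hQ₀ hA,
    ← Measure.setIntegral_toReal_rnDeriv hRQ]
  exact integral_congr_ae (ae_restrict_of_ae hR)

/-- If the density of `R` with respect to `Q` is `(dQ₀/dQ)_m`, then `R` and `Q` have the same
conditional expectations given `m`. -/
theorem condExp_eq_of_density (hm : m ≤ mΩ) (hRQ : (R : Measure Ω) ≪ (Q : Measure Ω))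
    (hQ₀ : (Q₀ : Measure Ω) ≪ (Q : Measure Ω))
    (hR : (fun ω => ((R : Measure Ω).rnDeriv (Q : Measure Ω) ω).toReal)
      =ᵐ[(Q : Measure Ω)] dens m Q Q₀) {Y : Ω → ℝ} (hY : MemLp Y ∞ (Q : Measure Ω)) :
    (R : Measure Ω)[Y | m] =ᵐ[(R : Measure Ω)] (Q : Measure Ω)[Y | m] := by
  have hYQ : Integrable Y (Q : Measure Ω) := hY.integrable le_top
  have hYR : Integrable Y (R : Measure Ω) := (memLp_top_of_ac hY hRQ).integrable le_top
  obtain ⟨c, hc⟩ := ae_bound_of_memLp_top hY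
  have hbd : ∀ᵐ ω ∂(Q : Measure Ω), |((Q : Measure Ω)[Y | m]) ω| ≤ c :=
    ae_bdd_abs_condExp_of_ae_bdd_abs hc
  have hint : ∀ ν : ProbabilityMeasure Ω, (ν : Measure Ω) ≪ (Q : Measure Ω) →
      Integrable ((Q : Measure Ω)[Y | m]) (ν : Measure Ω) := fun ν hν =>
    Integrable.of_bound (stronglyMeasurable_condExp.mono hm).aestronglyMeasurable c (hν hbd)
  refine (ae_eq_condExp_of_forall_setIntegral_eq hm hYR
    (fun A hA _ => (hint R hRQ).integrableOn) (fun A hA _ => ?_)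
    stronglyMeasurable_condExp.aestronglyMeasurable).symm
  have h1 : Integrable (fun ω => ((R : Measure Ω).rnDeriv (Q : Measure Ω) ω).toReal * Y ω)
      (Q : Measure Ω) := (integrable_toReal_rnDeriv_mul_iff hRQ).2 hYR
  have h2 : Integrable (dens m Q Q₀ * Y) (Q : Measure Ω) :=
    h1.congr (hR.mono fun ω h => by simp only [Pi.mul_apply]; rw [← h])
  have h3 := condExp_mul_of_stronglyMeasurable_left (m := m) (f := dens m Q Q₀)
    stronglyMeasurable_condExp h2 hYQ
  -- An `m`-measurable integrand sees only the restriction to `m`, where `R` is `Q₀`. The weight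
  -- `dens m Q Q₀` then enters, is absorbed into the conditional expectation, and is recognised as
  -- `dR/dQ`.
  calc ∫ ω in A, ((Q : Measure Ω)[Y | m]) ω ∂(R : Measure Ω)
      = ∫ ω in A, ((Q : Measure Ω)[Y | m]) ω ∂(Q₀ : Measure Ω) :=
        setIntegral_eq_of_trim_eq hm (trim_eq_of_density hm hRQ hQ₀ hR)
          stronglyMeasurable_condExp hA
    _ = ∫ ω in A, ((Q : Measure Ω)[Y | m]) ω * dens m Q Q₀ ω ∂(Q : Measure Ω) :=
        (setIntegral_mul_dens hm hQ₀ stronglyMeasurable_condExp (hint Q₀ hQ₀) hA).2.symm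
    _ = ∫ ω in A, ((Q : Measure Ω)[dens m Q Q₀ * Y | m]) ω ∂(Q : Measure Ω) := by
        refine integral_congr_ae (ae_restrict_of_ae (h3.mono fun ω h => ?_))
        rw [h, Pi.mul_apply, mul_comm]
    _ = ∫ ω in A, ((R : Measure Ω).rnDeriv (Q : Measure Ω) ω).toReal * Y ω ∂(Q : Measure Ω) := by
        rw [setIntegral_condExp hm h2 hA]
        refine integral_congr_ae (ae_restrict_of_ae (hR.mono fun ω h => ?_))
        simp only [Pi.mul_apply, h]
    _ = ∫ ω in A, Y ω ∂(R : Measure Ω) := setIntegral_toReal_rnDeriv_mul hRQ (hm _ hA)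

theorem ac_of_density (hm : m ≤ mΩ) (hRQ : (R : Measure Ω) ≪ (Q : Measure Ω))
    (hQ₀ : (Q₀ : Measure Ω) ≪ (Q : Measure Ω)) (hQQ₀ : (Q : Measure Ω) ≪ (Q₀ : Measure Ω))
    (hR : (fun ω => ((R : Measure Ω).rnDeriv (Q : Measure Ω) ω).toReal)
      =ᵐ[(Q : Measure Ω)] dens m Q Q₀) : (Q : Measure Ω) ≪ (R : Measure Ω) := by
  rw [← Measure.withDensity_rnDeriv_eq _ _ hRQ]
  refine withDensity_absolutelyContinuous' (Measure.measurable_rnDeriv _ _).aemeasurable ?_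
  filter_upwards [hR, dens_pos hm hQ₀ hQQ₀] with ω h1 h2 h3
  rw [← h1, h3] at h2
  simp at h2

end Density

/-! ### Stopped σ-algebras and terminal densities. -/

section Stopping

variable {Ω : Type*} {mΩ : MeasurableSpace Ω} {F : Filtration ℝ≥0 mΩ}

theorem StopTime.sigma_le (τ : StopTime F) : τ.sigma ≤ mΩ := τ.2.measurableSpace_le

/-- A subset of `{τ = ∞}` never meets `{τ ≤ i}`, so `F_τ` and the full σ-algebra have the same trace
on `{τ = ∞}`. -/
theorem StopTime.condExp_eq_self_on_top (hF : ⨆ t, F t = mΩ) (τ : StopTime F)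
    {μ : Measure Ω} [IsFiniteMeasure μ] {Y : Ω → ℝ} (hYm : StronglyMeasurable Y)
    (hY : Integrable Y μ) :
    ∀ᵐ ω ∂μ, τ.1 ω = ⊤ → (μ[Y | τ.sigma]) ω = Y ω := by
  have hmeas : ∀ t : Set Ω, MeasurableSet[τ.sigma] ({ω | τ.1 ω = ⊤} ∩ t) ↔
      MeasurableSet ({ω | τ.1 ω = ⊤} ∩ t) := by
    refine fun t => ⟨fun h => τ.sigma_le _ h, fun h => ⟨hF.ge _ h, fun i => ?_⟩⟩
    convert @MeasurableSet.empty Ω (F i)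
    ext ω
    simp only [mem_inter_iff, mem_ofPred_eq, mem_empty_iff_false, iff_false]
    rintro ⟨⟨h1, -⟩, h2⟩
    exact (WithTop.coe_lt_top i).not_ge (h1 ▸ h2)
  have htop : MeasurableSet {ω | τ.1 ω = ⊤} := τ.2.measurable' (measurableSet_singleton ⊤)
  have htop' : MeasurableSet[τ.sigma] {ω | τ.1 ω = ⊤} := by
    have := hmeas univ
    rw [inter_univ] at this
    exact this.2 htop
  have h := condExp_ae_eq_restrict_of_measurableSpace_eq_on (f := Y) (μ := μ) τ.sigma_le le_rfl
    htop' hmeas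
  rw [condExp_of_stronglyMeasurable le_rfl hYm hY] at h
  exact (ae_restrict_iff' htop).1 h

/-- The stopping time equal to `σ` on `A` and to `∞` elsewhere. -/
noncomputable def StopTime.restrict (σ : StopTime F) (A : Set Ω) (hA : MeasurableSet[σ.sigma] A) :
    StopTime F := by
  classical
  refine ⟨fun ω => if ω ∈ A then σ.1 ω else ⊤, fun t => ?_⟩
  convert hA.2 t using 1
  ext ω
  by_cases h : ω ∈ A
  · simp [h]
  · simpa [h] using (WithTop.coe_lt_top t).not_ge

theorem StopTime.restrict_of_mem (σ : StopTime F) {A : Set Ω} (hA : MeasurableSet[σ.sigma] A)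
    {ω : Ω} (h : ω ∈ A) : (σ.restrict A hA).1 ω = σ.1 ω := if_pos h

theorem StopTime.restrict_of_notMem (σ : StopTime F) {A : Set Ω} (hA : MeasurableSet[σ.sigma] A)
    {ω : Ω} (h : ω ∉ A) : (σ.restrict A hA).1 ω = ⊤ := if_neg h

theorem StopTime.le_restrict (σ : StopTime F) {A : Set Ω} (hA : MeasurableSet[σ.sigma] A) :
    σ.1 ≤ (σ.restrict A hA).1 := fun ω => by
  by_cases h : ω ∈ A
  · rw [σ.restrict_of_mem hA h]
  · rw [σ.restrict_of_notMem hA h]; exact le_top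

theorem StopTime.condExp_restrict (σ : StopTime F) {A : Set Ω} (hA : MeasurableSet[σ.sigma] A)
    {μ : Measure Ω} [IsFiniteMeasure μ] {Y : Ω → ℝ} :
    ∀ᵐ ω ∂μ, ω ∈ A → (μ[Y | (σ.restrict A hA).sigma]) ω = (μ[Y | σ.sigma]) ω := by
  have hle : σ.sigma ≤ (σ.restrict A hA).sigma :=
    IsStoppingTime.measurableSpace_mono _ _ (σ.le_restrict hA)
  refine (ae_restrict_iff' (σ.sigma_le _ hA)).1
    (condExp_ae_eq_restrict_of_measurableSpace_eq_on (σ.restrict A hA).sigma_le σ.sigma_le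
      (hle _ hA) fun t => ⟨fun h => ⟨h.1, fun i => ?_⟩, fun h => hle _ h⟩)
  convert h.2 i using 1
  ext ω
  simp only [mem_inter_iff, mem_ofPred_eq]
  refine and_congr_right fun hω => ?_
  rw [σ.restrict_of_mem hA hω.1]

/-- Lévy's upward theorem along the integer times, which are cofinal and so generate the same
σ-algebra. -/
theorem tendsto_dens (hF : ⨆ t, F t = mΩ) (P Q : ProbabilityMeasure Ω) :
    ∀ᵐ ω ∂(P : Measure Ω), Tendsto (fun n : ℕ => dens (F n) P Q ω) atTop
      (𝓝 ((Q : Measure Ω).rnDeriv (P : Measure Ω) ω).toReal) := by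
  let G : Filtration ℕ mΩ := ⟨fun n => F n, fun i j h => F.mono (Nat.cast_le.2 h), fun i => F.le _⟩
  have hG : ⨆ n, G n = mΩ := by
    refine le_antisymm (iSup_le fun n => G.le n) (hF.ge.trans (iSup_le fun t => ?_))
    exact (F.mono (Nat.le_ceil t)).trans (le_iSup (fun n => G n) ⌈t⌉₊)
  have h := MeasureTheory.tendsto_ae_condExp (μ := (P : Measure Ω)) (ℱ := G)
    fun ω => ((Q : Measure Ω).rnDeriv (P : Measure Ω) ω).toReal
  rw [hG, condExp_of_stronglyMeasurable le_rfl
    (Measure.measurable_rnDeriv _ _).ennreal_toReal.stronglyMeasurable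
    Measure.integrable_toReal_rnDeriv] at h
  exact h

/-- A measure whose density process is that of `Q` stopped at `τ` has terminal density
`(dQ/dP)_τ`. -/
theorem rnDeriv_eq_dens_of_stopped (hF : ⨆ t, F t = mΩ) {P Q R : ProbabilityMeasure Ω}
    (τ : StopTime F) (h : ∀ t : ℝ≥0,
      (∀ᵐ ω ∂(P : Measure Ω), (t : WithTop ℝ≥0) ≤ τ.1 ω →
        dens (F t) P R ω = dens (F t) P Q ω) ∧
      (∀ᵐ ω ∂(P : Measure Ω), τ.1 ω ≤ (t : WithTop ℝ≥0) →
        dens (F t) P R ω = dens τ.sigma P Q ω)) :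
    (fun ω => ((R : Measure Ω).rnDeriv (P : Measure Ω) ω).toReal)
      =ᵐ[(P : Measure Ω)] dens τ.sigma P Q := by
  have h1 := ae_all_iff.2 fun n : ℕ => (h n).1
  have h2 := ae_all_iff.2 fun n : ℕ => (h n).2
  filter_upwards [h1, h2, tendsto_dens hF P R, tendsto_dens hF P Q,
    τ.condExp_eq_self_on_top (μ := (P : Measure Ω)) hF
      (Measure.measurable_rnDeriv (Q : Measure Ω) (P : Measure Ω)).ennreal_toReal.stronglyMeasurable
      Measure.integrable_toReal_rnDeriv] with ω h1 h2 hR hQ htop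
  -- If `τ = ∞` the two density processes agree at every integer time; if `τ` is finite that of `R`
  -- is eventually constant.
  by_cases hω : τ.1 ω = ⊤
  · rw [dens, htop hω]
    refine tendsto_nhds_unique hR (hQ.congr fun n => (h1 n ?_).symm)
    rw [hω]; exact le_top
  · obtain ⟨t, ht⟩ := WithTop.ne_top_iff_exists.1 hω
    refine tendsto_nhds_unique hR (tendsto_const_nhds.congr' ?_)
    filter_upwards [eventually_ge_atTop ⌈t⌉₊] with n hn
    refine (h2 n ?_).symm
    rw [← ht, WithTop.coe_le_coe]
    exact (Nat.le_ceil t).trans (Nat.cast_le.2 hn)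

end Stopping

/-! ### Essential suprema of directed families. -/

section EssSup

variable {Ω : Type*} {m mΩ : MeasurableSpace Ω}

/-- The essential supremum of a uniformly bounded, upward directed family of `m`-measurable
functions is the almost sure limit of a sequence of members of the family. -/
theorem exists_seq_tendsto_essSup (hm : m ≤ mΩ) (μ : Measure Ω) [IsProbabilityMeasure μ]
    {ι : Type*} [Nonempty ι] {g : ι → Ω → ℝ} {c : ℝ} (hg : ∀ i, StronglyMeasurable[m] (g i))
    (hb : ∀ i, ∀ᵐ ω ∂μ, |g i ω| ≤ c) (hdir : ∀ i j, ∃ k, g i ≤ᵐ[μ] g k ∧ g j ≤ᵐ[μ] g k) :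
    ∃ (u : ℕ → ι) (Y : Ω → ℝ), StronglyMeasurable[m] Y ∧ (∀ᵐ ω ∂μ, |Y ω| ≤ c) ∧
      (∀ i, g i ≤ᵐ[μ] Y) ∧ ∀ᵐ ω ∂μ, Tendsto (fun n => g (u n) ω) atTop (𝓝 (Y ω)) := by
  have hint : ∀ i, Integrable (g i) μ := fun i =>
    Integrable.of_bound ((hg i).mono hm).aestronglyMeasurable c (hb i)
  have hbdd : BddAbove (range fun i => ∫ ω, g i ω ∂μ) := by
    refine ⟨c, ?_⟩
    rintro _ ⟨i, rfl⟩
    calc ∫ ω, g i ω ∂μ ≤ ∫ _, c ∂μ :=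
          integral_mono_ae (hint i) (integrable_const c) ((hb i).mono fun ω h => (abs_le.1 h).2)
      _ = c := by simp
  set s : ℝ := ⨆ i, ∫ ω, g i ω ∂μ with hs
  have hv : ∀ n : ℕ, ∃ i, s - 1 / ((n : ℝ) + 1) < ∫ ω, g i ω ∂μ := fun n =>
    exists_lt_of_lt_ciSup (by linarith [Nat.one_div_pos_of_nat (α := ℝ) (n := n)])
  choose v hv using hv
  choose k hk1 hk2 using hdir
  -- Each term dominates the previous one and the next term of the maximising sequence `v`, so the
  -- integrals along `u` also tend to `s`.
  let u : ℕ → ι := fun n => Nat.rec (v 0) (fun n i => k i (v (n + 1))) n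
  have hu : ∀ n, g (u n) ≤ᵐ[μ] g (u (n + 1)) := fun n => hk1 _ _
  have huv : ∀ n, g (v n) ≤ᵐ[μ] g (u n) := by
    rintro (_ | n)
    · exact EventuallyLE.refl _ _
    · exact hk2 _ _
  have hmono : ∀ᵐ ω ∂μ, Monotone fun n => g (u n) ω := by
    filter_upwards [ae_all_iff.2 hu] with ω hω
    exact monotone_nat_of_le_succ hω
  have hball : ∀ᵐ ω ∂μ, ∀ n, |g (u n) ω| ≤ c := ae_all_iff.2 fun n => hb (u n)
  have hbd : ∀ᵐ ω ∂μ, BddAbove (range fun n => g (u n) ω) := by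
    filter_upwards [hball] with ω hω
    refine ⟨c, ?_⟩
    rintro _ ⟨n, rfl⟩
    exact (abs_le.1 (hω n)).2
  have hlim : ∀ᵐ ω ∂μ, Tendsto (fun n => g (u n) ω) atTop (𝓝 (⨆ n, g (u n) ω)) := by
    filter_upwards [hmono, hbd] with ω h1 h2
    exact tendsto_atTop_ciSup h1 h2
  refine ⟨u, fun ω => ⨆ n, g (u n) ω, ?_, ?_, fun i => ?_, hlim⟩
  · exact (Measurable.iSup fun n => (hg (u n)).measurable).stronglyMeasurable
  · filter_upwards [hlim, hball] with ω h1 h2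
    exact le_of_tendsto h1.abs (Eventually.of_forall h2)
  · set Y : Ω → ℝ := fun ω => ⨆ n, g (u n) ω
    -- A common upper bound of `g i` and `g (u n)` has integral at most `s`, while that of `g (u n)`
    -- exceeds `s - 1/(n+1)`. Hence `g i` can exceed `Y ≥ g (u n)` only by this much in mean.
    have hle : ∀ n : ℕ, ∫ ω, max (g i ω - Y ω) 0 ∂μ ≤ 1 / ((n : ℝ) + 1) := by
      intro n
      have h1 : ∫ ω, g (k i (u n)) ω ∂μ ≤ s := le_ciSup hbdd (k i (u n))
      have h2 : ∫ ω, g (v n) ω ∂μ ≤ ∫ ω, g (u n) ω ∂μ :=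
        integral_mono_ae (hint _) (hint _) (huv n)
      calc ∫ ω, max (g i ω - Y ω) 0 ∂μ
          ≤ ∫ ω, (g (k i (u n)) ω - g (u n) ω) ∂μ := by
            refine integral_mono_of_nonneg (Eventually.of_forall fun ω => le_max_right _ _)
              ((hint _).sub (hint _)) ?_
            filter_upwards [hk1 i (u n), hk2 i (u n), hbd] with ω h3 h4 h5
            refine max_le ?_ (sub_nonneg.2 h4)
            exact sub_le_sub h3 (le_ciSup h5 n)
        _ = ∫ ω, g (k i (u n)) ω ∂μ - ∫ ω, g (u n) ω ∂μ := integral_sub (hint _) (hint _)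
        _ ≤ _ := by linarith [hv n]
    have h0 : ∫ ω, max (g i ω - Y ω) 0 ∂μ = 0 := by
      refine le_antisymm (ge_of_tendsto' tendsto_one_div_add_atTop_nhds_zero_nat hle)
        (integral_nonneg fun ω => le_max_right _ _)
    have hYm : StronglyMeasurable Y :=
      ((Measurable.iSup fun n => (hg (u n)).measurable).stronglyMeasurable).mono hm
    have hYb : ∀ᵐ ω ∂μ, ‖Y ω‖ ≤ c := by
      filter_upwards [hlim, hball] with ω h1 h2
      exact le_of_tendsto h1.abs (Eventually.of_forall h2)
    have hYi : Integrable Y μ := Integrable.of_bound hYm.aestronglyMeasurable c hYb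
    have hpi : Integrable (fun ω => max (g i ω - Y ω) 0) μ := ((hint i).sub hYi).pos_part
    have hnn : 0 ≤ fun ω => max (g i ω - Y ω) 0 := fun ω => le_max_right _ _
    rw [integral_eq_zero_iff_of_nonneg hnn hpi] at h0
    filter_upwards [h0] with ω hω
    have := le_max_left (g i ω - Y ω) 0
    simp only [Pi.zero_apply] at hω
    linarith

end EssSup

/-! ### Pasting of measures and conditional suprema. -/

section Pasting

variable {Ω : Type*} {m' m mΩ : MeasurableSpace Ω} {F : Filtration ℝ≥0 mΩ} {P : ProbabilityMeasure Ω}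
  {T : Set (ProbabilityMeasure Ω)}

theorem condExp_eq_of_trim_eq (hm' : m' ≤ m) (hm : m ≤ mΩ)
    {μ ν : Measure Ω} [IsFiniteMeasure μ] [IsFiniteMeasure ν] (h : μ.trim hm = ν.trim hm)
    {f : Ω → ℝ} (hf : StronglyMeasurable[m] f) (hμ : Integrable f μ) (hν : Integrable f ν) :
    μ[f | m'] =ᵐ[μ] ν[f | m'] := by
  have hsm : StronglyMeasurable[m] (ν[f | m']) := stronglyMeasurable_condExp.mono hm'
  have hi : Integrable (ν[f | m']) μ :=
    integrable_of_integrable_trim hm (h ▸ integrable_condExp.trim hm hsm)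
  refine (ae_eq_condExp_of_forall_setIntegral_eq (hm'.trans hm) hμ
    (fun A _ _ => hi.integrableOn) (fun A hA _ => ?_)
    stronglyMeasurable_condExp.aestronglyMeasurable).symm
  rw [setIntegral_eq_of_trim_eq hm h hsm (hm' _ hA), setIntegral_condExp (hm'.trans hm) hν hA,
    setIntegral_eq_of_trim_eq hm h hf (hm' _ hA)]

/-- A nonempty set of probability measures equivalent to `P` which is stable under pasting at
stopping times: the pasted measure follows `Q₀` up to `τ` and `Q` afterwards. -/
structure IsEquivPasting (F : Filtration ℝ≥0 mΩ) (P : ProbabilityMeasure Ω)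
    (T : Set (ProbabilityMeasure Ω)) : Prop where
  nonempty : T.Nonempty
  ac : ∀ Q ∈ T, (Q : Measure Ω) ≪ (P : Measure Ω)
  ca : ∀ Q ∈ T, (P : Measure Ω) ≪ (Q : Measure Ω)
  paste : ∀ Q₀ ∈ T, ∀ Q ∈ T, ∀ τ : StopTime F, ∃ R ∈ T, ∀ Y : Ω → ℝ, MemLp Y ∞ (P : Measure Ω) →
    ∀ m ≤ τ.sigma, (R : Measure Ω)[Y | m] =ᵐ[(P : Measure Ω)]
      (Q₀ : Measure Ω)[(Q : Measure Ω)[Y | τ.sigma] | m]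

/-- `Y` is an upper bound for the conditional expectations of `-X` under the elements of `T`, and
the almost sure limit of a sequence of such conditional expectations. -/
structure IsCondSup (m : MeasurableSpace Ω) {mΩ : MeasurableSpace Ω} (P : ProbabilityMeasure Ω)
    (T : Set (ProbabilityMeasure Ω)) (X Y : Ω → ℝ) : Prop where
  measurable : AEStronglyMeasurable[m] Y (P : Measure Ω)
  upper : ∀ Q ∈ T, (Q : Measure Ω)[fun ω => -X ω | m] ≤ᵐ[(P : Measure Ω)] Y
  approx : ∃ u : ℕ → ProbabilityMeasure Ω, (∀ n, u n ∈ T) ∧ ∀ᵐ ω ∂(P : Measure Ω),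
    Tendsto (fun n => (((u n : Measure Ω))[fun ω => -X ω | m]) ω) atTop (𝓝 (Y ω))

theorem IsCondSup.le {X Y Z : Ω → ℝ} (h : IsCondSup m P T X Y)
    (hZ : ∀ Q ∈ T, (Q : Measure Ω)[fun ω => -X ω | m] ≤ᵐ[(P : Measure Ω)] Z) :
    Y ≤ᵐ[(P : Measure Ω)] Z := by
  obtain ⟨u, hu, hlim⟩ := h.approx
  filter_upwards [hlim, ae_all_iff.2 fun n => hZ (u n) (hu n)] with ω h1 h2
  exact le_of_tendsto' h1 h2

/-- Switching from `Q₂` to `Q₁` at time `σ` exactly where `Q₁` gives the larger value yields the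
pointwise maximum. The switching time is `σ` on that set and `∞` elsewhere. -/
theorem IsEquivPasting.directed (hF : ⨆ t, F t = mΩ) (hT : IsEquivPasting F P T) (σ : StopTime F)
    {Y : Ω → ℝ} (hYm : StronglyMeasurable Y) (hY : MemLp Y ∞ (P : Measure Ω))
    {Q₁ Q₂ : ProbabilityMeasure Ω} (h₁ : Q₁ ∈ T) (h₂ : Q₂ ∈ T) :
    ∃ R ∈ T, (Q₁ : Measure Ω)[Y | σ.sigma] ≤ᵐ[(P : Measure Ω)] (R : Measure Ω)[Y | σ.sigma] ∧
      (Q₂ : Measure Ω)[Y | σ.sigma] ≤ᵐ[(P : Measure Ω)] (R : Measure Ω)[Y | σ.sigma] := by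
  set g₁ := (Q₁ : Measure Ω)[Y | σ.sigma] with hg₁
  set g₂ := (Q₂ : Measure Ω)[Y | σ.sigma] with hg₂
  have hg₁m : StronglyMeasurable[σ.sigma] g₁ := stronglyMeasurable_condExp
  have hA : MeasurableSet[σ.sigma] {ω | g₂ ω ≤ g₁ ω} :=
    measurableSet_le stronglyMeasurable_condExp.measurable hg₁m.measurable
  set A := {ω | g₂ ω ≤ g₁ ω} with hAdef
  obtain ⟨R, hR, hRY⟩ := hT.paste Q₂ h₂ Q₁ h₁ (σ.restrict A hA)
  have hYi : ∀ Q ∈ T, Integrable Y (Q : Measure Ω) := fun Q hQ =>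
    (memLp_top_of_ac hY (hT.ac Q hQ)).integrable le_top
  have hg₁i : Integrable g₁ (Q₂ : Measure Ω) :=
    (memLp_top_of_ac ((memLp_top_of_ac hY (hT.ac Q₁ h₁)).condExp le_top)
      ((hT.ac Q₂ h₂).trans (hT.ca Q₁ h₁))).integrable le_top
  have hAm : MeasurableSet A := σ.sigma_le _ hA
  have hdecomp : (Q₁ : Measure Ω)[Y | (σ.restrict A hA).sigma] =ᵐ[(P : Measure Ω)]
      A.indicator g₁ + Aᶜ.indicator Y := by
    filter_upwards [hT.ca Q₁ h₁ (StopTime.condExp_eq_self_on_top hF (σ.restrict A hA) hYm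
      (hYi Q₁ h₁)), hT.ca Q₁ h₁ (StopTime.condExp_restrict σ hA (μ := (Q₁ : Measure Ω)) (Y := Y))]
      with ω e1 e2
    by_cases hω : ω ∈ A
    · rw [e2 hω]
      simp [hω, hg₁]
    · rw [e1 (σ.restrict_of_notMem hA hω)]
      simp [hω]
  have hV : (R : Measure Ω)[Y | σ.sigma] =ᵐ[(P : Measure Ω)] A.indicator g₁ + Aᶜ.indicator g₂ := by
    refine (hRY Y hY _ (IsStoppingTime.measurableSpace_mono _ _ (σ.le_restrict hA))).trans ?_
    refine hT.ca Q₂ h₂ ?_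
    refine (condExp_congr_ae (hT.ac Q₂ h₂ hdecomp)).trans ?_
    refine (condExp_add (hg₁i.indicator hAm) ((hYi Q₂ h₂).indicator hAm.compl) _).trans ?_
    refine EventuallyEq.add ?_ (condExp_indicator (hYi Q₂ h₂) hA.compl)
    rw [condExp_of_stronglyMeasurable σ.sigma_le (hg₁m.indicator hA) (hg₁i.indicator hAm)]
  refine ⟨R, hR, ?_, ?_⟩ <;> filter_upwards [hV] with ω hω <;> rw [hω] <;> by_cases h : ω ∈ A
  · simp [h]
  · have h' : g₁ ω < g₂ ω := not_le.1 h
    simp [h, h'.le]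
  · have h' : g₂ ω ≤ g₁ ω := h
    simp [h, h']
  · simp [h]

theorem IsEquivPasting.exists_isCondSup (hF : ⨆ t, F t = mΩ) (hT : IsEquivPasting F P T)
    (σ : StopTime F) (X : Lp ℝ ∞ (P : Measure Ω)) :
    ∃ Y : Lp ℝ ∞ (P : Measure Ω), IsCondSup σ.sigma P T X Y := by
  have hXm : StronglyMeasurable fun ω => -X ω := (Lp.stronglyMeasurable X).neg
  have hX : MemLp (fun ω => -X ω) ∞ (P : Measure Ω) := (Lp.memLp X).neg
  obtain ⟨c, hc⟩ := ae_bound_of_memLp_top hX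
  have : Nonempty T := hT.nonempty.to_subtype
  obtain ⟨u, Y, hYm, hYb, hYu, hYl⟩ := exists_seq_tendsto_essSup σ.sigma_le (P : Measure Ω)
    (ι := T) (g := fun Q => (Q.1 : Measure Ω)[fun ω => -X ω | σ.sigma]) (c := c)
    (fun Q => stronglyMeasurable_condExp)
    (fun Q => hT.ca Q Q.2 (ae_bdd_abs_condExp_of_ae_bdd_abs (hT.ac Q Q.2 hc)))
    (fun Q₁ Q₂ => by
      obtain ⟨R, hR, h⟩ := hT.directed hF σ hXm hX Q₁.2 Q₂.2
      exact ⟨⟨R, hR⟩, h⟩)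
  have hYL : MemLp Y ∞ (P : Measure Ω) :=
    memLp_top_of_bound (hYm.mono σ.sigma_le).aestronglyMeasurable c hYb
  have hcoe := hYL.coeFn_toLp
  refine ⟨hYL.toLp Y, hYm.aestronglyMeasurable.congr hcoe.symm, fun Q hQ => ?_,
    fun n => u n, fun n => (u n).2, ?_⟩
  · exact (hYu ⟨Q, hQ⟩).trans hcoe.symm.le
  · filter_upwards [hYl, hcoe] with ω h1 h2
    rw [h2]
    exact h1

end Pasting

/-! ### Properties of the dynamic risk measure. -/

section RiskMeasure

variable {Ω : Type*} {m mΩ : MeasurableSpace Ω} {F : Filtration ℝ≥0 mΩ} {P : ProbabilityMeasure Ω}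
  {T S : Set (ProbabilityMeasure Ω)} {X X' Z Z' : Ω → ℝ}

theorem IsCondSup.isCondEssSup
    (hT : ∀ Q, Q ∈ T ↔ Q ∈ S ∧ (Q : Measure Ω) ≪ (P : Measure Ω) ∧
      (P : Measure Ω) ≪ (Q : Measure Ω)) {X Y : Lp ℝ ∞ (P : Measure Ω)} (hm : m ≤ mΩ)
    (h : IsCondSup m P T X Y) : IsCondEssSup m P S X Y := by
  constructor
  · rintro g ⟨Q, hQ, h1, h2, hg⟩
    exact AEEqFun.coeFn_le.1 (hg.le.trans (h.upper Q ((hT Q).2 ⟨hQ, h1, h2⟩)))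
  · intro g hg
    refine AEEqFun.coeFn_le.1 (h.le fun Q hQ => ?_)
    have hQ' := (hT Q).1 hQ
    have hsm : AEStronglyMeasurable ((Q : Measure Ω)[fun ω => -X ω | m]) (P : Measure Ω) :=
      (stronglyMeasurable_condExp.mono hm).aestronglyMeasurable
    have hmem : AEEqFun.mk _ hsm ∈ condFamily m P S X :=
      ⟨Q, hQ'.1, hQ'.2.1, hQ'.2.2, AEEqFun.coeFn_mk _ _⟩
    exact (AEEqFun.coeFn_mk _ hsm).symm.le.trans (AEEqFun.coeFn_le.2 (hg hmem))

theorem IsEquivPasting.integrable (hT : IsEquivPasting F P T) (hX : MemLp X ∞ (P : Measure Ω))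
    {Q : ProbabilityMeasure Ω} (hQ : Q ∈ T) : Integrable X (Q : Measure Ω) :=
  (memLp_top_of_ac hX (hT.ac Q hQ)).integrable le_top

theorem IsCondSup.mono (hT : IsEquivPasting F P T) (hX : MemLp X ∞ (P : Measure Ω))
    (hX' : MemLp X' ∞ (P : Measure Ω)) (hXX' : X ≤ᵐ[(P : Measure Ω)] X')
    (h : IsCondSup m P T X Z) (h' : IsCondSup m P T X' Z') : Z' ≤ᵐ[(P : Measure Ω)] Z := by
  refine h'.le fun Q hQ => EventuallyLE.trans (hT.ca Q hQ ?_) (h.upper Q hQ)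
  exact condExp_mono (hT.integrable hX' hQ).neg (hT.integrable hX hQ).neg
    (by filter_upwards [hT.ac Q hQ hXX'] with ω h using neg_le_neg h)

theorem IsEquivPasting.isCondSup_congr (hT : IsEquivPasting F P T) (hX : X =ᵐ[(P : Measure Ω)] X')
    (h : IsCondSup m P T X Z) : IsCondSup m P T X' Z := by
  have hc : ∀ Q ∈ T, (Q : Measure Ω)[fun ω => -X ω | m] =ᵐ[(P : Measure Ω)]
      (Q : Measure Ω)[fun ω => -X' ω | m] := fun Q hQ =>
    hT.ca Q hQ (condExp_congr_ae (by
      filter_upwards [hT.ac Q hQ hX] with ω h using congrArg Neg.neg h))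
  obtain ⟨u, hu, hlim⟩ := h.approx
  refine ⟨h.measurable, fun Q hQ => (hc Q hQ).symm.le.trans (h.upper Q hQ), u, hu, ?_⟩
  filter_upwards [hlim, ae_all_iff.2 fun n => hc (u n) (hu n)] with ω h1 h2
  exact h1.congr h2

theorem coeFn_smul_add_smul (a b : ℝ) (X Y : Lp ℝ ∞ (P : Measure Ω)) :
    ⇑(a • X + b • Y) =ᵐ[(P : Measure Ω)] a • ⇑X + b • ⇑Y :=
  (Lp.coeFn_add _ _).trans ((Lp.coeFn_smul a X).add (Lp.coeFn_smul b Y))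

theorem IsCondSup.add_le (hm : m ≤ mΩ) (hT : IsEquivPasting F P T)
    (hX : MemLp X ∞ (P : Measure Ω)) (hX' : MemLp X' ∞ (P : Measure Ω))
    (hX'm : AEStronglyMeasurable[m] X' (P : Measure Ω))
    (h : IsCondSup m P T X Z) (h' : IsCondSup m P T (X + X') Z') :
    Z' ≤ᵐ[(P : Measure Ω)] Z - X' := by
  refine h'.le fun Q hQ => ?_
  have h1 : (Q : Measure Ω)[fun ω => -(X + X') ω | m] =ᵐ[(Q : Measure Ω)]
      (Q : Measure Ω)[fun ω => -X ω | m] + fun ω => -X' ω := by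
    have e : (fun ω => -(X + X') ω) = (fun ω => -X ω) + fun ω => -X' ω := by
      ext ω; simp only [Pi.add_apply]; ring
    rw [e]
    refine (condExp_add (hT.integrable hX hQ).neg (hT.integrable hX' hQ).neg m).trans ?_
    refine EventuallyEq.add EventuallyEq.rfl ?_
    exact condExp_of_aestronglyMeasurable' hm (hX'm.neg.mono_ac (hT.ac Q hQ))
      (hT.integrable hX' hQ).neg
  filter_upwards [hT.ca Q hQ h1, h.upper Q hQ] with ω h2 h3
  rw [h2]
  simp only [Pi.add_apply, Pi.sub_apply]
  linarith

theorem IsCondSup.convex (hT : IsEquivPasting F P T) {V : Ω → ℝ}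
    (hX : MemLp X ∞ (P : Measure Ω)) (hX' : MemLp X' ∞ (P : Measure Ω)) {a b : ℝ} (ha : 0 ≤ a)
    (hb : 0 ≤ b) (h : IsCondSup m P T X Z) (h' : IsCondSup m P T X' Z')
    (hV : IsCondSup m P T (a • X + b • X') V) :
    V ≤ᵐ[(P : Measure Ω)] a • Z + b • Z' := by
  refine hV.le fun Q hQ => ?_
  have h1 : (Q : Measure Ω)[fun ω => -(a • X + b • X') ω | m] =ᵐ[(Q : Measure Ω)]
      a • (Q : Measure Ω)[fun ω => -X ω | m] + b • (Q : Measure Ω)[fun ω => -X' ω | m] := by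
    have e : (fun ω => -(a • X + b • X') ω) = (a • fun ω => -X ω) + b • fun ω => -X' ω := by
      ext ω; simp only [Pi.add_apply, Pi.smul_apply, smul_eq_mul]; ring
    rw [e]
    refine (condExp_add ((hT.integrable hX hQ).neg.smul a)
      ((hT.integrable hX' hQ).neg.smul b) m).trans ?_
    exact EventuallyEq.add (condExp_smul a _ m) (condExp_smul b _ m)
  filter_upwards [hT.ca Q hQ h1, h.upper Q hQ, h'.upper Q hQ] with ω h2 h3 h4
  rw [h2]
  simp only [Pi.add_apply, Pi.smul_apply, smul_eq_mul]
  exact add_le_add (mul_le_mul_of_nonneg_left h3 ha) (mul_le_mul_of_nonneg_left h4 hb)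

theorem IsCondSup.smul (hT : IsEquivPasting F P T) {a : ℝ} (ha : 0 ≤ a)
    (h : IsCondSup m P T X Z) (h' : IsCondSup m P T (a • X) Z') :
    Z' =ᵐ[(P : Measure Ω)] a • Z := by
  have h1 : ∀ Q ∈ T, (Q : Measure Ω)[fun ω => -(a • X) ω | m] =ᵐ[(P : Measure Ω)]
      a • (Q : Measure Ω)[fun ω => -X ω | m] := fun Q hQ => by
    have e : (fun ω => -(a • X) ω) = (a • fun ω => -X ω) := by
      ext ω; simp
    rw [e]
    exact hT.ca Q hQ (condExp_smul a _ m)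
  refine EventuallyLE.antisymm (h'.le fun Q hQ => ?_) ?_
  · filter_upwards [h1 Q hQ, h.upper Q hQ] with ω h2 h3
    rw [h2]
    exact mul_le_mul_of_nonneg_left h3 ha
  · obtain ⟨u, hu, hlim⟩ := h.approx
    filter_upwards [hlim, ae_all_iff.2 fun n => h1 (u n) (hu n),
      ae_all_iff.2 fun n => h'.upper (u n) (hu n)] with ω h2 h3 h4
    refine le_of_tendsto' (h2.const_mul a) fun n => ?_
    refine le_trans (le_of_eq ?_) (h4 n)
    rw [h3 n]
    rfl

/-- One inequality is the tower property. For the other, `V` is a limit of `E_{u n}(-X | F_τ)`, and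
following `Q` up to `τ` and `u n` afterwards stays in `T`, so the conditional expectation under `Q`
of each approximant is bounded by `Z`. -/
theorem IsCondSup.timeConsistent (hT : IsEquivPasting F P T) {σ τ : StopTime F}
    (hστ : σ.1 ≤ τ.1) {V : Ω → ℝ} (hX : MemLp X ∞ (P : Measure Ω))
    (hV : MemLp V ∞ (P : Measure Ω)) (hZ : MemLp Z ∞ (P : Measure Ω))
    (hτ : IsCondSup τ.sigma P T X V) (hσ : IsCondSup σ.sigma P T X Z)
    (hσ' : IsCondSup σ.sigma P T (-V) Z') : Z' =ᵐ[(P : Measure Ω)] Z := by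
  have hle : σ.sigma ≤ τ.sigma := IsStoppingTime.measurableSpace_mono _ _ hστ
  have hce : ∀ Q ∈ T, MemLp ((Q : Measure Ω)[fun ω => -X ω | τ.sigma]) ∞ (P : Measure Ω) :=
    fun Q hQ => memLp_top_of_ac
      ((memLp_top_of_ac hX.neg (hT.ac Q hQ)).condExp le_top) (hT.ca Q hQ)
  have hVV : (fun ω => -(-V) ω) = V := by ext ω; simp
  refine EventuallyLE.antisymm (hσ'.le fun Q hQ => ?_) (hσ.le fun Q hQ => ?_)
  · rw [hVV]
    obtain ⟨u, hu, hlim⟩ := hτ.approx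
    have hVQ := hT.integrable hV hQ
    have hZQ := hT.integrable hZ hQ
    refine hT.ca Q hQ ?_
    -- The limit is taken in integrals over sets of `F_σ`; testing on all of them then recovers the
    -- almost sure inequality.
    have hset : ∀ A, MeasurableSet[σ.sigma] A →
        ∫ ω in A, V ω ∂(Q : Measure Ω) ≤ ∫ ω in A, Z ω ∂(Q : Measure Ω) := by
      intro A hA
      obtain ⟨c, hc⟩ := ae_bound_of_memLp_top hX.neg
      have hlimA : Tendsto
          (fun n => ∫ ω in A, ((u n : Measure Ω)[fun ω => -X ω | τ.sigma]) ω ∂(Q : Measure Ω))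
          atTop (𝓝 (∫ ω in A, V ω ∂(Q : Measure Ω))) := by
        refine tendsto_integral_of_dominated_convergence (fun _ => (c : ℝ))
          (fun n => (stronglyMeasurable_condExp.mono τ.sigma_le).aestronglyMeasurable)
          (integrable_const _) (fun n => ae_restrict_of_ae ?_)
          (ae_restrict_of_ae (hT.ac Q hQ hlim))
        exact hT.ac Q hQ (hT.ca _ (hu n)
          (ae_bdd_abs_condExp_of_ae_bdd_abs (hT.ac _ (hu n) hc)))
      refine le_of_tendsto' hlimA fun n => ?_
      obtain ⟨R, hR, hRX⟩ := hT.paste Q hQ (u n) (hu n) τ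
      have h1 := hRX _ hX.neg σ.sigma hle
      rw [← setIntegral_condExp σ.sigma_le (hT.integrable (hce _ (hu n)) hQ) hA]
      refine setIntegral_mono_ae integrable_condExp.integrableOn hZQ.integrableOn ?_
      refine hT.ac Q hQ ?_
      filter_upwards [h1, hσ.upper R hR] with ω h2 h3
      exact h2 ▸ h3
    have hZc : (Q : Measure Ω)[Z | σ.sigma] =ᵐ[(Q : Measure Ω)] Z :=
      condExp_of_aestronglyMeasurable' σ.sigma_le (hσ.measurable.mono_ac (hT.ac Q hQ)) hZQ
    refine EventuallyLE.trans ?_ hZc.le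
    refine ae_le_of_ae_le_trim (hm := σ.sigma_le) ?_
    refine ae_le_of_forall_setIntegral_le
      (integrable_condExp.trim σ.sigma_le stronglyMeasurable_condExp)
      (integrable_condExp.trim σ.sigma_le stronglyMeasurable_condExp) fun A hA _ => ?_
    rw [← setIntegral_trim σ.sigma_le stronglyMeasurable_condExp hA,
      ← setIntegral_trim σ.sigma_le stronglyMeasurable_condExp hA,
      setIntegral_condExp σ.sigma_le hVQ hA, setIntegral_condExp σ.sigma_le hZQ hA]
    exact hset A hA
  · refine EventuallyLE.trans (hT.ca Q hQ ?_) (hσ'.upper Q hQ)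
    rw [hVV]
    refine (condExp_condExp_of_le hle τ.sigma_le).symm.le.trans ?_
    exact condExp_mono integrable_condExp (hT.integrable hV hQ) (hT.ac Q hQ (hτ.upper Q hQ))

theorem isDynamicRiskMeasure (hT : IsEquivPasting F P T)
    {ρ : StopTime F → Lp ℝ ∞ (P : Measure Ω) → Lp ℝ ∞ (P : Measure Ω)}
    (hρ : ∀ (σ : StopTime F) (X : Lp ℝ ∞ (P : Measure Ω)), IsCondSup σ.sigma P T X (ρ σ X)) :
    IsDynamicRiskMeasure F P ρ where
  adapted σ X := (hρ σ X).measurable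
  monotone σ X Y h := (Lp.coeFn_le _ _).1
    ((hρ σ X).mono hT (Lp.memLp X) (Lp.memLp Y) ((Lp.coeFn_le _ _).2 h) (hρ σ Y))
  translation σ X Y hY := by
    have key : ∀ U W : Lp ℝ ∞ (P : Measure Ω), AEStronglyMeasurable[σ.sigma] W (P : Measure Ω) →
        ρ σ (U + W) ≤ ρ σ U - W := fun U W hW => by
      refine (Lp.coeFn_le _ _).1 (EventuallyLE.trans ?_ (Lp.coeFn_sub _ _).symm.le)
      refine (hρ σ U).add_le σ.sigma_le hT (Lp.memLp U) (Lp.memLp W) hW ?_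
      exact hT.isCondSup_congr (Lp.coeFn_add U W) (hρ σ (U + W))
    refine le_antisymm (key X Y hY) ?_
    -- The reverse inequality is the same one, with the translation undone.
    have h := key (X + Y) (-Y) (hY.neg.congr (Lp.coeFn_neg Y).symm)
    rw [add_neg_cancel_right, sub_neg_eq_add] at h
    exact sub_le_iff_le_add.2 h
  convex σ X Y a ha ha' := by
    refine (Lp.coeFn_le _ _).1 (EventuallyLE.trans ?_ (coeFn_smul_add_smul _ _ _ _).symm.le)
    exact (hρ σ X).convex hT (Lp.memLp X) (Lp.memLp Y) ha (sub_nonneg.2 ha') (hρ σ Y)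
      (hT.isCondSup_congr (coeFn_smul_add_smul _ _ _ _) (hρ σ _))
  posHom σ X a ha := Lp.ext <| by
    refine EventuallyEq.trans ?_ (Lp.coeFn_smul _ _).symm
    exact (hρ σ X).smul hT ha (hT.isCondSup_congr (Lp.coeFn_smul _ _) (hρ σ _))

theorem isTimeConsistent (hT : IsEquivPasting F P T)
    {ρ : StopTime F → Lp ℝ ∞ (P : Measure Ω) → Lp ℝ ∞ (P : Measure Ω)}
    (hρ : ∀ (σ : StopTime F) (X : Lp ℝ ∞ (P : Measure Ω)), IsCondSup σ.sigma P T X (ρ σ X)) :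
    IsTimeConsistent F P ρ := fun σ τ hστ X => Lp.ext <|
  IsCondSup.timeConsistent hT hστ (Lp.memLp X) (Lp.memLp _) (Lp.memLp _) (hρ τ X) (hρ σ X)
    (hT.isCondSup_congr (Lp.coeFn_neg _) (hρ σ _))

end RiskMeasure

/-! ### Construction of the dominating measure. -/

section Dominating

variable {Ω : Type*} [MeasurableSpace Ω]

theorem IsConvex.exists_mix {C : Set (ProbabilityMeasure Ω)} (hC : IsConvex C)
    {Q Q' : ProbabilityMeasure Ω} (hQ : Q ∈ C) (hQ' : Q' ∈ C) {a b : ℝ≥0} (hab : a + b = 1) :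
    ∃ R ∈ C, (R : Measure Ω) = a • (Q : Measure Ω) + b • (Q' : Measure Ω) := by
  obtain ⟨R, hR, h⟩ := hC ⟨Q, hQ, rfl⟩ ⟨Q', hQ', rfl⟩ (zero_le (a := a)) (zero_le (a := b)) hab
  exact ⟨R, hR, h⟩

/-- The leftover weight `2^{-N}` goes to `Q N`, which keeps the total mass 1. The induction averages
`Q 0` with the combination built from the shifted sequence, hence the quantifier over `Q`. -/
theorem IsConvex.exists_partial_geometric {C : Set (ProbabilityMeasure Ω)} (hC : IsConvex C)
    (N : ℕ) : ∀ Q : ℕ → ProbabilityMeasure Ω, (∀ n, Q n ∈ C) → ∃ R ∈ C, (R : Measure Ω) =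
      ∑ n ∈ Finset.range N, (2⁻¹ : ℝ≥0) ^ (n + 1) • (Q n : Measure Ω)
        + (2⁻¹ : ℝ≥0) ^ N • (Q N : Measure Ω) := by
  induction N with
  | zero => exact fun Q hQ => ⟨Q 0, hQ 0, by simp⟩
  | succ N ih =>
    intro Q hQ
    obtain ⟨R, hR, h⟩ := ih (fun n => Q (n + 1)) fun n => hQ _
    obtain ⟨R', hR', h'⟩ := hC.exists_mix (hQ 0) hR (a := 2⁻¹) (b := 2⁻¹)
      (by rw [← two_mul]; exact mul_inv_cancel₀ two_ne_zero)
    refine ⟨R', hR', ?_⟩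
    rw [h', h, Finset.sum_range_succ', smul_add, Finset.smul_sum]
    simp only [smul_smul, ← pow_succ', zero_add, pow_one]
    abel

variable [TopologicalSpace Ω] [PolishSpace Ω] [BorelSpace Ω]

/-- A compact convex set of probability measures contains a measure which dominates the elements of
a countable dense subset. -/
theorem exists_dominating {C : Set (ProbabilityMeasure Ω)} (hne : C.Nonempty) (hC : IsConvex C)
    (hcomp : IsCompact C) : ∃ Q : ℕ → ProbabilityMeasure Ω, (∀ n, Q n ∈ C) ∧
      C ⊆ closure (range Q) ∧ ∃ P ∈ C, ∀ n,
        (2⁻¹ : ℝ≥0∞) ^ (n + 1) • (Q n : Measure Ω) ≤ (P : Measure Ω) := by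
  obtain ⟨D, hDC, hDc, hD⟩ := hcomp.isSeparable.exists_countable_dense_subset
  have hDne : D.Nonempty := closure_nonempty_iff.1 (hne.mono hD)
  obtain ⟨Q, rfl⟩ := hDc.exists_eq_range hDne
  have hQ : ∀ n, Q n ∈ C := fun n => hDC (mem_range_self n)
  refine ⟨Q, hQ, hD, ?_⟩
  let μ : Measure Ω := Measure.sum fun n => (2⁻¹ : ℝ≥0∞) ^ (n + 1) • (Q n : Measure Ω)
  have hμ : IsProbabilityMeasure μ := by
    constructor
    simp only [μ, Measure.sum_apply _ MeasurableSet.univ, Measure.smul_apply, measure_univ,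
      smul_eq_mul, mul_one]
    rw [ENNReal.tsum_geometric_add_one, ENNReal.one_sub_inv_two, inv_inv]
    exact ENNReal.inv_mul_cancel two_ne_zero ENNReal.ofNat_ne_top
  choose R hR hRe using fun N => hC.exists_partial_geometric N Q hQ
  let P : ProbabilityMeasure Ω := ⟨μ, hμ⟩
  have hlim : Tendsto R atTop (𝓝 P) := by
    rw [ProbabilityMeasure.tendsto_iff_forall_lintegral_tendsto]
    intro f
    have h1 : ∀ N, ∫⁻ ω, f ω ∂(R N : Measure Ω) =
        ∑ n ∈ Finset.range N, (2⁻¹ : ℝ≥0∞) ^ (n + 1) * ∫⁻ ω, f ω ∂(Q n : Measure Ω)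
          + (2⁻¹ : ℝ≥0∞) ^ N * ∫⁻ ω, f ω ∂(Q N : Measure Ω) := by
      intro N
      rw [hRe, lintegral_add_measure, lintegral_finsetSum_measure]
      simp only [lintegral_smul_measure, ENNReal.smul_def, smul_eq_mul, ENNReal.coe_pow,
        ENNReal.coe_inv_two]
    have h2 : ∫⁻ ω, f ω ∂(P : Measure Ω) = ∑' n, (2⁻¹ : ℝ≥0∞) ^ (n + 1) * ∫⁻ ω, f ω ∂(Q n : Measure Ω) := by
      change ∫⁻ ω, f ω ∂μ = _
      simp only [μ, lintegral_sum_measure, lintegral_smul_measure, smul_eq_mul]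
    simp only [h1, h2]
    rw [← add_zero (∑' n, _)]
    -- The leftover term is at most `2^{-N}` times the bound of `f`, hence negligible.
    refine (ENNReal.tendsto_nat_tsum _).add ?_
    have hb : ∀ N, ∫⁻ ω, f ω ∂(Q N : Measure Ω) ≤ nndist f 0 := by
      intro N
      calc ∫⁻ ω, f ω ∂(Q N : Measure Ω) ≤ ∫⁻ _, (nndist f 0 : ℝ≥0∞) ∂(Q N : Measure Ω) := by
            exact lintegral_mono fun ω => ENNReal.coe_le_coe.2
              (BoundedContinuousFunction.NNReal.upper_bound f ω)
        _ = _ := by simp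
    have hz : Tendsto (fun N : ℕ => (2⁻¹ : ℝ≥0∞) ^ N * (nndist f 0 : ℝ≥0∞)) atTop (𝓝 0) := by
      have := ENNReal.Tendsto.mul_const (b := (nndist f 0 : ℝ≥0∞))
        (ENNReal.tendsto_pow_atTop_nhds_zero_of_lt_one (r := 2⁻¹) ENNReal.one_half_lt_one)
        (Or.inr ENNReal.coe_ne_top)
      rwa [zero_mul] at this
    exact tendsto_of_tendsto_of_tendsto_of_le_of_le tendsto_const_nhds hz (fun _ => zero_le)
      fun N => mul_le_mul_right (hb N) _
  exact ⟨P, hcomp.isClosed.mem_of_tendsto hlim (Eventually.of_forall hR),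
    fun n => Measure.le_sum (fun n => (2⁻¹ : ℝ≥0∞) ^ (n + 1) • (Q n : Measure Ω)) n⟩

end Dominating

/-! ### Membership in the canonical class. -/

section CanonicalClass

variable {Ω : Type*} [TopologicalSpace Ω] [MeasurableSpace Ω]
  {C : Set (ProbabilityMeasure Ω)} {P Q : ProbabilityMeasure Ω}

theorem integral_neg_le_riskMeasure (hQ : Q ∈ C) (X : Ω →ᵇ ℝ) :
    ∫ ω, -X ω ∂(Q : Measure Ω) ≤ riskMeasure C X :=
  le_csSup (bddAbove_riskMeasure C X) ⟨Q, hQ, rfl⟩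

variable [BorelSpace Ω]

theorem riskMeasure_le_of_dense {ι : Type*} {Q : ι → ProbabilityMeasure Ω} (hne : C.Nonempty)
    (hQ : C ⊆ closure (range Q)) (X : Ω →ᵇ ℝ) {b : ℝ}
    (h : ∀ i, ∫ ω, -X ω ∂(Q i : Measure Ω) ≤ b) : riskMeasure C X ≤ b := by
  refine csSup_le (hne.image _) ?_
  rintro _ ⟨R, hR, rfl⟩
  have hcont : Continuous fun R : ProbabilityMeasure Ω => ∫ ω, -X ω ∂(R : Measure Ω) :=
    continuous_iff_continuousAt.2 fun R =>
      ProbabilityMeasure.tendsto_iff_forall_integral_tendsto.1 tendsto_id (-X)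
  have hcl : IsClosed {R : ProbabilityMeasure Ω | ∫ ω, -X ω ∂(R : Measure Ω) ≤ b} :=
    isClosed_le hcont continuous_const
  exact hcl.closure_subset_iff.2 (range_subset_iff.2 h) (hQ hR)

theorem inUnitBall_of_mem (hP : P ∈ C) : InUnitBall (riskCapacity C) P := fun X => by
  refine (abs_integral_le_integral_abs).trans ?_
  refine le_trans (le_of_eq ?_) (integral_neg_le_riskMeasure hP (-|X|))
  simp

theorem toL1_coe (hP : P ∈ C) (W : CapSpace (riskCapacity C)) :
    toL1 (riskCapacity C) P W = BoundedContinuousFunction.toLp 1 (P : Measure Ω) ℝ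
      (CapSpace.toBCF (riskCapacity C) W) :=
  UniformSpace.Completion.extension_coe (uniformContinuous_toLp C P (inUnitBall_of_mem hP)) W

theorem continuous_toL1 (c : Seminorm ℝ (Ω →ᵇ ℝ)) (P : ProbabilityMeasure Ω) :
    Continuous (toL1 c P) := UniformSpace.Completion.continuous_extension

theorem norm_toL1_coe (hP : P ∈ C) (W : CapSpace (riskCapacity C)) :
    ‖toL1 (riskCapacity C) P W‖ =
      ∫ ω, |CapSpace.toBCF (riskCapacity C) W ω| ∂(P : Measure Ω) := by
  rw [toL1_coe hP, L1.norm_eq_integral_norm]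
  refine integral_congr_ae ?_
  filter_upwards [BoundedContinuousFunction.coeFn_toLp (p := 1) (P : Measure Ω) ℝ
    (CapSpace.toBCF (riskCapacity C) W)] with ω hω
  rw [hω, Real.norm_eq_abs]

theorem toL1_sub (hP : P ∈ C) (X Y : L1Cap (riskCapacity C)) :
    toL1 (riskCapacity C) P (X - Y) =
      toL1 (riskCapacity C) P X - toL1 (riskCapacity C) P Y := by
  have hc := continuous_toL1 (riskCapacity C) P
  refine UniformSpace.Completion.induction_on₂ X Y ?_ fun V W => ?_
  · exact isClosed_eq (hc.comp (continuous_fst.sub continuous_snd))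
      ((hc.comp continuous_fst).sub (hc.comp continuous_snd))
  · rw [← UniformSpace.Completion.coe_sub, toL1_coe hP, toL1_coe hP, toL1_coe hP, map_sub, map_sub]

theorem norm_toL1_le (hP : P ∈ C) (X : L1Cap (riskCapacity C)) :
    ‖toL1 (riskCapacity C) P X‖ ≤ ‖X‖ := by
  refine UniformSpace.Completion.induction_on X ?_ fun W => ?_
  · exact isClosed_le (continuous_toL1 _ P).norm continuous_norm
  · rw [toL1_coe hP, UniformSpace.Completion.norm_coe]
    exact norm_toLp_le C P (inUnitBall_of_mem hP) _

/-- Domination up to a constant, unlike mere absolute continuity, is a norm inequality, and so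
passes from continuous functions to the completion. -/
theorem norm_toL1_le_of_dominated (hP : P ∈ C) (hQ : Q ∈ C) {a : ℝ≥0∞}
    (h : a • (Q : Measure Ω) ≤ (P : Measure Ω)) (X : L1Cap (riskCapacity C)) :
    a.toReal * ‖toL1 (riskCapacity C) Q X‖ ≤ ‖toL1 (riskCapacity C) P X‖ := by
  refine UniformSpace.Completion.induction_on X ?_ fun W => ?_
  · exact isClosed_le (continuous_const.mul (continuous_toL1 _ Q).norm) (continuous_toL1 _ P).norm
  · rw [norm_toL1_coe hP, norm_toL1_coe hQ, ← smul_eq_mul, ← integral_smul_measure]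
    refine integral_mono_measure h (Eventually.of_forall fun ω => abs_nonneg _) ?_
    exact (|CapSpace.toBCF (riskCapacity C) W|).integrable _

theorem inCanonicalClass_of_dominating (hne : C.Nonempty) {Q : ℕ → ProbabilityMeasure Ω}
    (hQC : ∀ n, Q n ∈ C) (hQ : C ⊆ closure (range Q)) (hP : P ∈ C) {a : ℕ → ℝ≥0∞}
    (ha : ∀ n, a n ≠ ∞) (ha' : ∀ n, a n ≠ 0)
    (h : ∀ n, a n • (Q n : Measure Ω) ≤ (P : Measure Ω)) :
    InCanonicalClass (riskCapacity C) P := by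
  refine ⟨inUnitBall_of_mem hP, fun X Y => ⟨fun hXY => ?_, fun hXY => hXY ▸ rfl⟩⟩
  rw [← sub_eq_zero, ← norm_le_zero_iff]
  set Z := X - Y
  have hZP : toL1 (riskCapacity C) P Z = 0 := by rw [toL1_sub hP, hXY, sub_self]
  have hZ : ∀ n, toL1 (riskCapacity C) (Q n) Z = 0 := by
    intro n
    have h1 := norm_toL1_le_of_dominated hP (hQC n) (h n) Z
    rw [hZP, norm_zero] at h1
    have h2 : 0 < (a n).toReal := ENNReal.toReal_pos (ha' n) (ha n)
    exact norm_le_zero_iff.1 (nonpos_of_mul_nonpos_right h1 h2)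
  refine le_of_forall_pos_le_add fun ε hε => ?_
  obtain ⟨W, hW⟩ := (UniformSpace.Completion.denseRange_coe
    (α := CapSpace (riskCapacity C))).exists_dist_lt Z (half_pos hε)
  rw [dist_eq_norm] at hW
  -- `Z` vanishes under every `Q n`, so the `L¹(Q n)` norm of `W` is at most the distance from `Z`
  -- to `W`, uniformly in `n`; weak density turns this into a bound on the capacity.
  have hWc : riskCapacity C (CapSpace.toBCF (riskCapacity C) W) ≤ ε / 2 := by
    refine riskMeasure_le_of_dense hne hQ _ fun n => ?_
    have h1 := norm_toL1_le (hQC n) (Z - W)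
    rw [toL1_sub (hQC n), hZ n, zero_sub, norm_neg, norm_toL1_coe (hQC n)] at h1
    refine le_trans (le_of_eq ?_) (h1.trans hW.le)
    simp
  calc ‖Z‖ = ‖(Z - W) + W‖ := by rw [sub_add_cancel]
    _ ≤ ‖Z - W‖ + ‖(W : L1Cap (riskCapacity C))‖ := norm_add_le _ _
    _ ≤ ε / 2 + ε / 2 := by
        refine add_le_add hW.le ?_
        rw [UniformSpace.Completion.norm_coe, CapSpace.norm_eq]
        exact hWc
    _ = 0 + ε := by ring

end CanonicalClass

/-! ### Trivial σ-algebras. -/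

section Trivial

variable {Ω : Type*} {m mΩ : MeasurableSpace Ω}

theorem condExp_of_trivial (hm : m ≤ mΩ) {μ : Measure Ω} [IsProbabilityMeasure μ]
    (h : ∀ A, MeasurableSet[m] A → μ A = 0 ∨ μ Aᶜ = 0) {f : Ω → ℝ} (hf : Integrable f μ) :
    μ[f | m] =ᵐ[μ] fun _ => ∫ ω, f ω ∂μ := by
  refine (ae_eq_condExp_of_forall_setIntegral_eq hm hf
    (fun A _ _ => (integrable_const _).integrableOn) (fun A hA _ => ?_)
    (@stronglyMeasurable_const _ _ m _ _).aestronglyMeasurable).symm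
  rcases h A hA with h0 | h1
  · rw [Measure.restrict_eq_zero.2 h0, integral_zero_measure, integral_zero_measure]
  · rw [Measure.restrict_eq_self_of_ae_mem (s := A) (mem_ae_iff.2 h1)]
    simp

/-- The density is constant, hence 1. The clause of m-stability on initial densities therefore
concerns `P` alone. -/
theorem eq_of_trivial_of_density (hm : m ≤ mΩ) {P R : ProbabilityMeasure Ω}
    (h : ∀ A, MeasurableSet[m] A → (P : Measure Ω) A = 0 ∨ (P : Measure Ω) Aᶜ = 0)
    (hRP : (R : Measure Ω) ≪ (P : Measure Ω))
    (hR : AEStronglyMeasurable[m]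
      (fun ω => ((R : Measure Ω).rnDeriv (P : Measure Ω) ω).toReal) (P : Measure Ω)) : R = P := by
  have h1 := condExp_of_trivial hm h
    (Measure.integrable_toReal_rnDeriv (μ := (R : Measure Ω)) (ν := (P : Measure Ω)))
  have h2 := condExp_of_aestronglyMeasurable' hm hR Measure.integrable_toReal_rnDeriv
  rw [Measure.integral_toReal_rnDeriv hRP, probReal_univ] at h1
  have h3 : (R : Measure Ω).rnDeriv (P : Measure Ω) =ᵐ[(P : Measure Ω)] 1 := by
    filter_upwards [h1, h2] with ω e1 e2
    exact (ENNReal.toReal_eq_one_iff _).1 (e2.symm.trans e1)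
  refine Subtype.ext ?_
  have h4 := Measure.withDensity_rnDeriv_eq _ _ hRP
  rw [withDensity_congr_ae h3, withDensity_one] at h4
  exact h4.symm

end Trivial

/-! ### From stability to pasting and m-stability. -/

section Stable

variable {Ω : Type*} {mΩ : MeasurableSpace Ω} {F : Filtration ℝ≥0 mΩ}
  {C : Set (ProbabilityMeasure Ω)} {P : ProbabilityMeasure Ω}

theorem IsStable.isEquivPasting (hF : ⨆ t, F t = mΩ) (hC : IsStable F C) (hP : P ∈ C) :
    IsEquivPasting F P {Q | Q ∈ C ∧ (Q : Measure Ω) ≪ (P : Measure Ω) ∧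
      (P : Measure Ω) ≪ (Q : Measure Ω)} where
  nonempty := ⟨P, hP, Measure.AbsolutelyContinuous.rfl, Measure.AbsolutelyContinuous.rfl⟩
  ac Q hQ := hQ.2.1
  ca Q hQ := hQ.2.2
  paste Q₀ hQ₀ Q hQ τ := by
    have hac : (Q₀ : Measure Ω) ≪ (Q : Measure Ω) := hQ₀.2.1.trans hQ.2.2
    have hca : (Q : Measure Ω) ≪ (Q₀ : Measure Ω) := hQ.2.1.trans hQ₀.2.2
    -- The reference measure is `Q`, not `P`: what is stopped is the density of `Q₀` with respect to
    -- `Q`, so `Q` governs after `τ`.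
    obtain ⟨R, hRC, hRQ, hR⟩ := hC Q hQ.1 Q₀ hQ₀.1 hac τ
    have hdens := rnDeriv_eq_dens_of_stopped hF τ hR
    have hPR : (P : Measure Ω) ≪ (R : Measure Ω) :=
      hQ.2.2.trans (ac_of_density τ.sigma_le hRQ hac hca hdens)
    refine ⟨R, ⟨hRC, hRQ.trans hQ.2.1, hPR⟩, fun Y hY => ?_⟩
    have hYQ := memLp_top_of_ac hY hQ.2.1
    have hi : ∀ ν : ProbabilityMeasure Ω, (ν : Measure Ω) ≪ (Q : Measure Ω) →
        Integrable ((Q : Measure Ω)[Y | τ.sigma]) (ν : Measure Ω) := fun ν hν =>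
      (memLp_top_of_ac (hYQ.condExp le_top) hν).integrable le_top
    have hcond := condExp_eq_of_density τ.sigma_le hRQ hac hdens hYQ
    have htrim := trim_eq_of_density τ.sigma_le hRQ hac hdens
    have hiR := hi R hRQ
    have hi₀ := hi Q₀ hac
    exact fun _ hm => hPR ((condExp_condExp_of_le hm τ.sigma_le).symm.trans
      ((condExp_congr_ae hcond).trans
        (condExp_eq_of_trim_eq hm τ.sigma_le htrim stronglyMeasurable_condExp hiR hi₀)))

theorem IsStable.isMStable (hC : IsStable F C) (hP : P ∈ C)
    (h : ∀ A, MeasurableSet[F 0] A → (P : Measure Ω) A = 0 ∨ (P : Measure Ω) Aᶜ = 0) :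
    IsMStable F P {Q | Q ∈ C ∧ (Q : Measure Ω) ≪ (P : Measure Ω)} where
  ac Q hQ := hQ.2
  paste Q₀ hQ₀ Q hQ hPQ τ := by
    have hac : (Q₀ : Measure Ω) ≪ (Q : Measure Ω) := hQ₀.2.trans hPQ
    obtain ⟨R, hRC, hRQ, hR⟩ := hC Q hQ.1 Q₀ hQ₀.1 hac τ
    refine ⟨R, ⟨hRC, hRQ.trans hQ.2⟩, fun t => ⟨?_, ?_⟩⟩
    · filter_upwards [hPQ (hR t).1, dens_mul (F.le t) hRQ hQ.2, dens_mul (F.le t) hac hQ.2]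
        with ω h1 h2 h3 hω
      rw [h2, h3, h1 hω]
    -- By the chain rule the density is `(dQ₀/dQ)_τ Z_t`, and `(dQ₀/dQ)_τ = Z⁰_τ / Z_τ` because `Z_τ
    -- > 0`.
    · filter_upwards [hPQ (hR t).2, dens_mul (F.le t) hRQ hQ.2, dens_mul τ.sigma_le hac hQ.2,
        dens_pos τ.sigma_le hQ.2 hPQ] with ω h1 h2 h3 h4 hω
      rw [h2, h3, h1 hω]
      field_simp
  initial R hRP hR := by
    rw [eq_of_trivial_of_density (F.le 0) h hRP hR]
    exact ⟨hP, Measure.AbsolutelyContinuous.rfl⟩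

end Stable

/-! ### Recovering the static risk measure at time 0. -/

section Static

variable {Ω : Type*} [TopologicalSpace Ω] {m : MeasurableSpace Ω} [mΩ : MeasurableSpace Ω]
  [BorelSpace Ω] {C : Set (ProbabilityMeasure Ω)} {P : ProbabilityMeasure Ω}

theorem isLUB_riskMeasure {S : Set (ProbabilityMeasure Ω)} (hne : C.Nonempty) (hS : S ⊆ C)
    {Q : ℕ → ProbabilityMeasure Ω} (hQ : C ⊆ closure (range Q)) (hQS : ∀ n, Q n ∈ S)
    (X : Ω →ᵇ ℝ) :
    IsLUB ((fun Q : ProbabilityMeasure Ω => ∫ ω, -X ω ∂(Q : Measure Ω)) '' S)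
      (riskMeasure C X) := by
  constructor
  · rintro _ ⟨R, hR, rfl⟩
    exact integral_neg_le_riskMeasure (hS hR) X
  · exact fun b hb => riskMeasure_le_of_dense hne hQ X fun n => hb ⟨Q n, hQS n, rfl⟩

theorem IsCondSup.eq_riskMeasure (hm : m ≤ mΩ) (hne : C.Nonempty) (hC : IsConvex C) (hP : P ∈ C)
    (htriv : ∀ A, MeasurableSet[m] A → (P : Measure Ω) A = 0 ∨ (P : Measure Ω) Aᶜ = 0)
    {Q : ℕ → ProbabilityMeasure Ω} (hQC : ∀ n, Q n ∈ C) (hQ : C ⊆ closure (range Q))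
    (hQP : ∀ n, (Q n : Measure Ω) ≪ (P : Measure Ω)) {X : Ω →ᵇ ℝ} {Z : Ω → ℝ}
    (h : IsCondSup m P {Q | Q ∈ C ∧ (Q : Measure Ω) ≪ (P : Measure Ω) ∧
      (P : Measure Ω) ≪ (Q : Measure Ω)} X Z) :
    Z =ᵐ[(P : Measure Ω)] fun _ => riskMeasure C X := by
  have hce : ∀ R : ProbabilityMeasure Ω, (R : Measure Ω) ≪ (P : Measure Ω) →
      (P : Measure Ω) ≪ (R : Measure Ω) → (R : Measure Ω)[fun ω => -X ω | m]
        =ᵐ[(P : Measure Ω)] fun _ => ∫ ω, -X ω ∂(R : Measure Ω) := fun R hRP hPR =>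
    hPR (condExp_of_trivial hm (fun A hA => (htriv A hA).imp (fun h => hRP h) fun h => hRP h)
      (X.integrable _).neg)
  refine EventuallyLE.antisymm (h.le fun R hR => ?_) ?_
  · filter_upwards [hce R hR.2.1 hR.2.2] with ω hω
    rw [hω]
    exact integral_neg_le_riskMeasure hR.1 X
  -- `Q n` need not be equivalent to `P`; a share `1/(k+1)` of `P` makes it so within `C`, and `k →
  -- ∞` removes the share.
  · have hmix : ∀ n k : ℕ, ∀ᵐ ω ∂(P : Measure Ω),
        (1 - 1 / ((k : ℝ) + 1)) * ∫ ω, -X ω ∂(Q n : Measure Ω)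
          + 1 / ((k : ℝ) + 1) * ∫ ω, -X ω ∂(P : Measure Ω) ≤ Z ω := by
      intro n k
      set a : ℝ≥0 := 1 / ((k : ℝ≥0) + 1) with ha
      have ha1 : a ≤ 1 := by
        rw [ha, div_le_one (by positivity)]
        exact le_add_of_nonneg_left (zero_le)
      have ha0 : a ≠ 0 := by positivity
      obtain ⟨R, hR, hRe⟩ := hC.exists_mix (hQC n) hP (tsub_add_cancel_of_le ha1)
      have hRP : (R : Measure Ω) ≪ (P : Measure Ω) := by
        rw [hRe]
        exact ((hQP n).smul_left _).add_left (Measure.AbsolutelyContinuous.rfl.smul_left _)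
      have hPR : (P : Measure Ω) ≪ (R : Measure Ω) := by
        intro A hA
        rw [hRe, Measure.add_apply, add_eq_zero] at hA
        have hA' : (a : ℝ≥0∞) * (P : Measure Ω) A = 0 := hA.2
        exact (mul_eq_zero.1 hA').resolve_left (ENNReal.coe_ne_zero.2 ha0)
      have hI : ∫ ω, -X ω ∂(R : Measure Ω) = (1 - 1 / ((k : ℝ) + 1)) *
          ∫ ω, -X ω ∂(Q n : Measure Ω) + 1 / ((k : ℝ) + 1) * ∫ ω, -X ω ∂(P : Measure Ω) := by
        rw [hRe, integral_add_measure, integral_smul_nnreal_measure, integral_smul_nnreal_measure,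
          NNReal.smul_def, NNReal.smul_def, NNReal.coe_sub ha1]
        · simp [ha]
        · exact ((X.integrable _).neg).smul_measure_nnreal
        · exact ((X.integrable _).neg).smul_measure_nnreal
      filter_upwards [hce R hRP hPR, h.upper R ⟨hR, hRP, hPR⟩] with ω h1 h2
      rw [← hI, ← h1]
      exact h2
    filter_upwards [ae_all_iff.2 fun n => ae_all_iff.2 (hmix n)] with ω hω
    refine riskMeasure_le_of_dense hne hQ X fun n => ?_
    have hlim := ((tendsto_one_div_add_atTop_nhds_zero_nat (𝕜 := ℝ)).const_sub 1).mul_const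
      (∫ ω, -X ω ∂(Q n : Measure Ω)) |>.add
      (tendsto_one_div_add_atTop_nhds_zero_nat.mul_const (∫ ω, -X ω ∂(P : Measure Ω)))
    rw [sub_zero, one_mul, zero_mul, add_zero] at hlim
    exact le_of_tendsto' hlim (hω n)

end Static

end StableRisk

theorem mainTheorem6 {Ω : Type*} [TopologicalSpace Ω] [PolishSpace Ω] [mΩ : MeasurableSpace Ω]
    [BorelSpace Ω] (F : Filtration ℝ≥0 mΩ) (hFright : F.IsRightContinuous)
    (hFtop : ⨆ t, F t = mΩ)
    (C : Set (ProbabilityMeasure Ω)) (hCne : C.Nonempty) (hCconv : StableRisk.IsConvex C)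
    (hCcomp : IsCompact C) (hCstable : StableRisk.IsStable F C)
    (hFzero : ∀ P ∈ C, StableRisk.InCanonicalClass (StableRisk.riskCapacity C) P →
      ∀ A, MeasurableSet[F 0] A → (P : Measure Ω) A = 0 ∨ (P : Measure Ω) A = 1) :
    ∃ P ∈ C, StableRisk.InCanonicalClass (StableRisk.riskCapacity C) P ∧
      ∃ S : Set (ProbabilityMeasure Ω),
        StableRisk.IsMStable F P S ∧
        (∀ X : Ω →ᵇ ℝ, IsLUB ((fun Q : ProbabilityMeasure Ω => ∫ ω, -X ω ∂(Q : Measure Ω)) '' S)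
          (StableRisk.riskMeasure C X)) ∧
        ∃ ρ : StableRisk.StopTime F → Lp ℝ ∞ (P : Measure Ω) → Lp ℝ ∞ (P : Measure Ω),
          (∀ σ X, StableRisk.IsCondEssSup σ.sigma P S X (ρ σ X)) ∧
          StableRisk.IsDynamicRiskMeasure F P ρ ∧
          StableRisk.IsTimeConsistent F P ρ ∧
          ∀ X : Ω →ᵇ ℝ,
            ρ (StableRisk.StopTime.zero F)
                (BoundedContinuousFunction.toLp (E := ℝ) ∞ (P : Measure Ω) ℝ X)
              =ᵐ[(P : Measure Ω)] fun _ => StableRisk.riskMeasure C X := by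
  open StableRisk in
  obtain ⟨Q, hQC, hQ, P, hP, hQP⟩ := exists_dominating hCne hCconv hCcomp
  have hpow : ∀ n, (2⁻¹ : ℝ≥0∞) ^ (n + 1) ≠ 0 := fun n => by simp
  have hcan : InCanonicalClass (riskCapacity C) P :=
    inCanonicalClass_of_dominating hCne hQC hQ hP (fun n => by finiteness) hpow hQP
  have hQac : ∀ n, (Q n : Measure Ω) ≪ (P : Measure Ω) := fun n =>
    (Measure.absolutelyContinuous_smul (hpow n)).trans (Measure.absolutelyContinuous_of_le (hQP n))
  have htriv : ∀ A, MeasurableSet[F 0] A → (P : Measure Ω) A = 0 ∨ (P : Measure Ω) Aᶜ = 0 :=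
    fun A hA => (hFzero P hP hcan A hA).imp id fun h =>
      (prob_compl_eq_zero_iff (F.le 0 _ hA)).2 h
  have hT := hCstable.isEquivPasting hFtop hP
  choose ρ hρ using fun (σ : StopTime F) (X : Lp ℝ ∞ (P : Measure Ω)) =>
    hT.exists_isCondSup hFtop σ X
  -- `S` keeps the measures that are only absolutely continuous: the dense `Q n` belong to it and
  -- give the static representation.
  refine ⟨P, hP, hcan, {Q | Q ∈ C ∧ (Q : Measure Ω) ≪ (P : Measure Ω)},
    hCstable.isMStable hP htriv, isLUB_riskMeasure hCne (fun R hR => hR.1) hQ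
      fun n => ⟨hQC n, hQac n⟩, ρ, fun σ X => (hρ σ X).isCondEssSup ?_ σ.sigma_le,
    isDynamicRiskMeasure hT hρ, isTimeConsistent hT hρ, fun X => ?_⟩
  · refine fun R => ⟨fun h => ⟨⟨h.1, h.2.1⟩, h.2⟩, fun h => ⟨h.1.1, h.2⟩⟩
  · have hX := hT.isCondSup_congr (BoundedContinuousFunction.coeFn_toLp (p := ∞) (P : Measure Ω) ℝ X)
      (hρ (StopTime.zero F) (BoundedContinuousFunction.toLp (E := ℝ) ∞ (P : Measure Ω) ℝ X))
    refine hX.eq_riskMeasure (StopTime.zero F).sigma_le hCne hCconv hP (fun A hA => ?_) hQC hQ hQac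
    refine htriv A ?_
    rwa [← IsStoppingTime.measurableSpace_const F 0]
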